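/- **Definitions.** Let $\mathcal V$ be the category with objects $\mathbb C^m$ ($m\ge 0$) and morphisms the linear automorphisms, with $\oplus$ and $\otimes$ made strictly associative by ordering bases lexicographically. Let $M_n(\mathcal V)$ be the category of $n\times n$ matrices over $\mathcal V$, with product $(E\cdot F)_{ik}=\bigoplus_j E_{ij}\otimes F_{jk}$ on objects and morphisms, whose associators $E\cdot(F\cdot G)\to(E\cdot F)\cdot G$ are in each entry the canonical permutation of basis vectors. On $\mathbb Z\times\mathbb C^*$ put $(m,a)\oplus(k,b)=(m+k,ab)$ and $(m,a)\otimes(k,b)=(mk,a^kb^m)$; this is a commutative ring. For a morphism $\phi=(\phi_{ij})$ of $M_n(\mathcal V)$ let $\mathrm{Det}(\phi)\in\mathbb Z\times\mathbb C^*$ be the determinant, over this ring, of the matrix with entries $(\dim E_{ij},\det\phi_{ij})$. $\mathrm{Gl}_n(\mathcal V)$ is the full subcategory of those $E$ with $\det(\dim E_{ij})=\pm1$. For an associator $\alpha$, $\mathrm{Det}(\alpha)=(\pm1,\mathrm{sgn}(\alpha))$ with $\mathrm{sgn}(\alpha)\in\{\pm1\}$. The oriented version of $\mathrm{Gl}_n(\mathcal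 V)$ has the same objects, morphisms $(f,s)$ with $s\in\{\pm1\}$ (composed and multiplied componentwise), and associators $(\alpha,\mathrm{sgn}(\alpha))$; $P_{\mathrm{Gl}_n(\mathcal V)}$ forgets $s$. Let $X$ be a paracompact Hausdorff smooth manifold (possibly with boundary). An ordered open cover is an open cover $(U_\alpha)_{\alpha\in\mathcal J}$ with $\mathcal J$ partially ordered such that every finite set of indices whose members have a common point is totally ordered. A smooth charted (oriented) 2-vector bundle of rank $n\ge 0$ over $X$ consists of an ordered open cover, an object $E^{\alpha\beta}$ of $\mathrm{Gl}_n(\mathcal V)$ (of its oriented version) for $\alpha<\beta$, with $E^{\alpha\beta}\cdot E^{\beta\gamma}=E^{\alpha\gamma}$ for $\alpha<\beta<\gamma$ (all this only where the relevant intersection is nonempty), and smooth maps $\phi^{\alpha\beta\gamma}\colon U_{\alpha\beta\gamma}\to \mathrm{mor}(E^{\alpha\beta}\cdot E^{\beta\gamma},E^{\alpha\gamma})$ such that, for $\alpha<\beta<\gamma<\delta$ and at every point of $U_{\alpha\beta\gamma\delta}$, $$\phi^{\alpha\gamma\delta}\circ(\phi^{\alpha\beta\gamma}\cdot\mathrm{id})\circ\alpha^{\alpha\beta\gamma\delta}=\phi^{\alpha\beta\delta}\circ(\mathrm{id}\cdot\phi^{\beta\gamma\delta}),$$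 where $\alpha^{\alpha\beta\gamma\delta}$ is the associator of $E^{\alpha\beta},E^{\beta\gamma},E^{\gamma\delta}$. Two bundles $\mathcal E_0,\mathcal E_1$ over $X$ are equivalent if they are cobordant: there is a bundle over $X\times[0,1]$ whose coherency maps $\phi$ are constant in the direction of $[0,1]$ near both ends and whose restriction to $X\times\{t\}$ is $\mathcal E_t$ for $t=0,1$ (ignoring members of the covers that are empty, and up to renaming indices). A bundle is orientable if it is equivalent to the image of an oriented bundle under $P_{\mathrm{Gl}_n(\mathcal V)}$. **Statement.** For every smooth charted 2-vector bundle over $X$ the signs $\mathrm{sgn}(\alpha^{\alpha\beta\gamma\delta})$, extended to an alternating cochain on all 4-tuples of indices, form a 3-cocycle in the Čech complex $\check C^*(\mathcal U,\{\pm1\})$ of its cover $\mathcal U$. The class in the Čech cohomology $\check H^3(X,\{\pm1\})$ (the colimit over all open covers and refinements) that it represents depends only on the equivalence class of the bundle. This class is trivial if and only if the bundle is orientable. -/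

import Mathlib

open Set Topology TopologicalSpace
open scoped Manifold ContDiff TensorProduct

universe u

noncomputable section

namespace TwoVect

/-! ### The category `L_V` and its weakly strict ring structure -/

/-- The total space of morphisms `ℤ × ℂˣ` of the category `L_V`: the element `(m, a)` is the
automorphism `a` of the object `ℂ_m`. Composition multiplies the second entries; the functors `⊕`
and `⊗` are the addition and the multiplication below. -/
@[ext]
structure LV where
  obj : ℤ
  mor : ℂˣ

namespace LV

/-- `(m, a) ⊕ (k, b) = (m + k, a b)` -/
instance : Add LV := ⟨fun x y => ⟨x.obj + y.obj, x.mor * y.mor⟩⟩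

/-- `(m, a) ⊗ (k, b) = (m k, a ^ k b ^ m)` -/
instance : Mul LV := ⟨fun x y => ⟨x.obj * y.obj, x.mor ^ y.obj * y.mor ^ x.obj⟩⟩

/-- `i (m, a) = (-m, a⁻¹)` -/
instance : Neg LV := ⟨fun x => ⟨-x.obj, x.mor⁻¹⟩⟩

instance : Zero LV := ⟨⟨0, 1⟩⟩

instance : One LV := ⟨⟨1, 1⟩⟩

@[simp] theorem add_obj (x y : LV) : (x + y).obj = x.obj + y.obj := rfl
@[simp] theorem add_mor (x y : LV) : (x + y).mor = x.mor * y.mor := rfl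
@[simp] theorem mul_obj (x y : LV) : (x * y).obj = x.obj * y.obj := rfl
@[simp] theorem mul_mor (x y : LV) : (x * y).mor = x.mor ^ y.obj * y.mor ^ x.obj := rfl
@[simp] theorem neg_obj (x : LV) : (-x).obj = -x.obj := rfl
@[simp] theorem neg_mor (x : LV) : (-x).mor = x.mor⁻¹ := rfl
@[simp] theorem zero_obj : (0 : LV).obj = 0 := rfl
@[simp] theorem zero_mor : (0 : LV).mor = 1 := rfl
@[simp] theorem one_obj : (1 : LV).obj = 1 := rfl
@[simp] theorem one_mor : (1 : LV).mor = 1 := rfl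

/-- All associative, commutative and distributive laws hold weakly strictly in `L_V`. -/
instance : CommRing LV where
  add_assoc x y z := by ext <;> simp [add_assoc, mul_assoc]
  zero_add x := by ext <;> simp
  add_zero x := by ext <;> simp
  add_comm x y := by ext <;> simp [add_comm, mul_comm]
  neg_add_cancel x := by ext <;> simp
  mul_assoc x y z := by
    refine LV.ext (by simp [mul_assoc]) ?_
    simp only [mul_mor, mul_obj, mul_zpow, ← zpow_mul]
    rw [mul_assoc, mul_comm z.obj x.obj, mul_comm y.obj x.obj]
  one_mul x := by ext <;> simp
  mul_one x := by ext <;> simp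
  mul_comm x y := by ext <;> simp [mul_comm]
  left_distrib x y z := by
    refine LV.ext (by simp [mul_add]) ?_
    simp only [mul_mor, add_mor, add_obj, mul_zpow, zpow_add]
    exact mul_mul_mul_comm _ _ _ _
  right_distrib x y z := by
    refine LV.ext (by simp [add_mul]) ?_
    simp only [mul_mor, add_mor, add_obj, mul_zpow, zpow_add]
    exact mul_mul_mul_comm _ _ _ _
  zero_mul x := by ext <;> simp
  mul_zero x := by ext <;> simp
  nsmul := nsmulRec
  zsmul := zsmulRec

end LV

/-! ### The category `V` -/

/-- Morphisms `ℂ ^ a → ℂ ^ b` in `V`: linear isomorphisms. (There are none unless `a = b`.) -/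
abbrev VHom (a b : ℕ) : Type := (Fin a → ℂ) ≃ₗ[ℂ] (Fin b → ℂ)

theorem VHom.eq {a b : ℕ} (f : VHom a b) : a = b := by
  simpa using LinearEquiv.finrank_eq f

/-- The linear map permuting the standard basis: `e_p ↦ e_(σ p)`. -/
def VHom.ofEquiv {a b : ℕ} (σ : Fin a ≃ Fin b) : VHom a b :=
  LinearEquiv.funCongrLeft ℂ ℂ σ.symm

/-- The determinant of a morphism of `V`. Source and target are the same object. -/
def VHom.det {a b : ℕ} (f : VHom a b) : ℂˣ :=
  LinearEquiv.det (f.trans (VHom.ofEquiv (finCongr f.eq.symm)))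

/-! ### The monoidal category of matrices over `V` -/

/-- Objects of `M_n(V)`: the matrix of objects `ℂ ^ (A i j)` is recorded by the dimensions. The
monoidal product `⊕_j A i j ⊗ B j k` of objects is the product of these matrices. -/
abbrev Obj (n : ℕ) : Type := Matrix (Fin n) (Fin n) ℕ

/-- Morphisms of `M_n(V)`. -/
abbrev Mor {n : ℕ} (A B : Obj n) : Type := ∀ i j, VHom (A i j) (B i j)

variable {n : ℕ}

/-- Identity morphisms. -/
def Mor.id (A : Obj n) : Mor A A := fun _ _ => LinearEquiv.refl ℂ _

/-- Composition of morphisms (first `f`, then `g`). -/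
def Mor.comp {A B C : Obj n} (f : Mor A B) (g : Mor B C) : Mor A C :=
  fun i j => (f i j).trans (g i j)

/-- The standard basis of `⊕_j ℂ ^ (A i j) ⊗ ℂ ^ (B j k)`, in the lexicographic order. -/
def mulIndex (A B : Obj n) (i k : Fin n) :
    Fin ((A * B) i k) ≃ (Σ j : Fin n, Fin (A i j) × Fin (B j k)) :=
  (finCongr (Matrix.mul_apply (M := A) (N := B))).trans
    (finSigmaFinEquiv.symm.trans (Equiv.sigmaCongrRight fun _ => finProdFinEquiv.symm))

/-- The standard identification of `(A ⬝ B) i k` with `⊕_j A i j ⊗ B j k`. -/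
def mulSplit (A B : Obj n) (i k : Fin n) :
    (Fin ((A * B) i k) → ℂ) ≃ₗ[ℂ] ∀ j : Fin n, (Fin (A i j) → ℂ) ⊗[ℂ] (Fin (B j k) → ℂ) :=
  ((LinearEquiv.funCongrLeft ℂ ℂ (mulIndex A B i k).symm).trans
    (LinearEquiv.piCurry ℂ fun (_ : Fin n) _ => ℂ)).trans
    (LinearEquiv.piCongrRight fun j =>
      ((Pi.basisFun ℂ (Fin (A i j))).tensorProduct (Pi.basisFun ℂ (Fin (B j k)))).equivFun.symm)

/-- The monoidal product of morphisms: `(φ ⬝ ψ) i k = ⊕_j φ i j ⊗ ψ j k`. -/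
def Mor.mul {A A' B B' : Obj n} (φ : Mor A A') (ψ : Mor B B') : Mor (A * B) (A' * B') :=
  fun i k =>
    ((mulSplit A B i k).trans
      (LinearEquiv.piCongrRight fun j => TensorProduct.congr (φ i j) (ψ j k))).trans
      (mulSplit A' B' i k).symm

/-- The canonical bijection between the basis vectors of `⊕_j A i j ⊗ (⊕_k B j k ⊗ C k l)` and
those of `⊕_k (⊕_j A i j ⊗ B j k) ⊗ C k l`. -/
def assocIndex (A B C : Obj n) (i l : Fin n) :
    Fin ((A * (B * C)) i l) ≃ Fin ((A * B * C) i l) :=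
  (((mulIndex A (B * C) i l).trans
      (Equiv.sigmaCongrRight fun j => Equiv.prodCongrRight fun _ => mulIndex B C j l)).trans
    { toFun := fun x => ⟨x.2.2.1, ⟨x.1, x.2.1, x.2.2.2.1⟩, x.2.2.2.2⟩
      invFun := fun y => ⟨y.2.1.1, y.2.1.2.1, ⟨y.1, y.2.1.2.2, y.2.2⟩⟩
      left_inv := fun _ => rfl
      right_inv := fun _ => rfl }).trans
  ((mulIndex (A * B) C i l).trans
      (Equiv.sigmaCongrRight fun k => Equiv.prodCongrLeft fun _ => mulIndex A B i k)).symm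

/-- The associator `A ⬝ (B ⬝ C) → (A ⬝ B) ⬝ C`. -/
def assoc (A B C : Obj n) : Mor (A * (B * C)) (A * B * C) :=
  fun i l => VHom.ofEquiv (assocIndex A B C i l)

/-- The functor `Λ_*` from `M_n(V)` to `M_n(L_V)` on morphisms. -/
def Mor.lambda {A B : Obj n} (φ : Mor A B) : Matrix (Fin n) (Fin n) LV :=
  Matrix.of fun i j => ⟨(A i j : ℤ), (φ i j).det⟩

/-- The functor `Det` from `M_n(V)` to `L_V` on morphisms: the determinant of `Λ_*` with
coefficients in `L_V`. -/
def Mor.Det {A B : Obj n} (φ : Mor A B) : LV := φ.lambda.det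

/-- The functor `Det` on objects: the determinant of the matrix of dimensions. -/
def objDet (A : Obj n) : ℤ := (A.map (Nat.cast : ℕ → ℤ)).det

theorem VHom.det_ofEquiv_sq {a b : ℕ} (σ : Fin a ≃ Fin b) : (VHom.ofEquiv σ).det ^ 2 = 1 := by
  obtain rfl : a = b := (VHom.ofEquiv σ).eq
  have h : (VHom.ofEquiv σ).trans (VHom.ofEquiv (finCongr (VHom.ofEquiv σ).eq.symm))
      = VHom.ofEquiv σ := by
    ext v p
    rfl
  have h2 : ((VHom.ofEquiv σ : VHom a a) : (Fin a → ℂ) →ₗ[ℂ] (Fin a → ℂ))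
      = Matrix.toLin' (Equiv.Perm.permMatrix ℂ σ.symm) := by
    refine LinearMap.ext fun v => funext fun p => ?_
    simp [VHom.ofEquiv, Equiv.Perm.permMatrix, LinearMap.funLeft,
      PEquiv.toMatrix_toPEquiv_mulVec]
  unfold VHom.det
  rw [h]
  refine Units.ext ?_
  rw [Units.val_pow_eq_pow_val, LinearEquiv.coe_det, h2, LinearMap.det_toLin',
    Matrix.det_permutation]
  rcases Int.units_eq_one_or (Equiv.Perm.sign σ.symm) with h | h <;> rw [h] <;> simp

/-- `(m, a) ↦ (m, a ^ 2)` -/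
def LV.sq : LV →+* LV where
  toFun x := ⟨x.obj, x.mor ^ 2⟩
  map_one' := by ext <;> simp
  map_zero' := by ext <;> simp
  map_add' x y := by ext <;> simp [mul_pow]
  map_mul' x y := by
    refine LV.ext rfl ?_
    simp only [LV.mul_mor, mul_pow]
    rw [← zpow_natCast, ← zpow_natCast, ← zpow_natCast, ← zpow_natCast, ← zpow_mul, ← zpow_mul,
      ← zpow_mul, ← zpow_mul, mul_comm y.obj, mul_comm x.obj]

/-- `m ↦ (m, 1)` -/
def LV.incl : ℤ →+* LV where
  toFun m := ⟨m, 1⟩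
  map_one' := rfl
  map_zero' := rfl
  map_add' x y := by ext <;> simp
  map_mul' x y := by ext <;> simp

/-- `Det` of an associator is a sign. -/
theorem Det_assoc (A B C : Obj n) :
    ∃ s : ℤˣ, (assoc A B C).Det
      = ⟨objDet (A * (B * C)), Units.map (Int.castRingHom ℂ).toMonoidHom s⟩ := by
  have h1 : LV.sq (assoc A B C).Det = LV.incl (objDet (A * (B * C))) := by
    unfold Mor.Det objDet
    rw [RingHom.map_det, RingHom.map_det]
    congr 1
    ext i j
    · rfl
    · simp only [RingHom.mapMatrix_apply, Matrix.map_apply]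
      exact congrArg Units.val (VHom.det_ofEquiv_sq (assocIndex A B C i j))
  have ho := congrArg LV.obj h1
  have hm : (assoc A B C).Det.mor ^ 2 = 1 := congrArg LV.mor h1
  have hv : ((assoc A B C).Det.mor : ℂ) ^ 2 = 1 := by
    rw [← Units.val_pow_eq_pow_val, hm, Units.val_one]
  rcases mul_self_eq_one_iff.mp ((pow_two _).symm.trans hv) with h | h
  · exact ⟨1, LV.ext ho (Units.ext (by simpa using h))⟩
  · exact ⟨-1, LV.ext ho (Units.ext (by simpa using h))⟩

/-- The sign of the associator of three objects: the unique sign `s` with `Det = (_, s)`. -/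
def assocSgn (A B C : Obj n) : ℤˣ := (Det_assoc A B C).choose

/-- Objects of `Gl_n(V)` and of its oriented version: the weakly invertible matrices, i.e. the
preimage under `Det` of the objects `±1` of `L_V`. Both categories are full on these objects. -/
def WeaklyInvertible (A : Obj n) : Prop := IsUnit (objDet A)

/-! ### The oriented version of `Gl_n(V)` -/

/-- Morphisms of the oriented category: a morphism together with a sign. -/
abbrev OMor (A B : Obj n) : Type := Mor A B × ℤˣ

def OMor.id (A : Obj n) : OMor A A := (Mor.id A, 1)

def OMor.comp {A B C : Obj n} (f : OMor A B) (g : OMor B C) : OMor A C :=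
  (Mor.comp f.1 g.1, f.2 * g.2)

def OMor.mul {A A' B B' : Obj n} (f : OMor A A') (g : OMor B B') : OMor (A * B) (A' * B') :=
  (Mor.mul f.1 g.1, f.2 * g.2)

/-- The associator of the oriented category, which carries the sign of the associator. -/
def oassoc (A B C : Obj n) : OMor (A * (B * C)) (A * B * C) :=
  (assoc A B C, assocSgn A B C)

/-! ### Open covers and Čech cohomology with coefficients in `{±1}` -/

/-- An indexed open cover. -/
structure OpenCover (X : Type u) [TopologicalSpace X] where
  ι : Type u
  U : ι → Opens X
  exists_mem : ∀ x, ∃ i, x ∈ U i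

/-- An ordered open cover: the index set is partially ordered, and every finite set of indices
whose members have a common point is totally ordered. -/
structure OrderedOpenCover (X : Type u) [TopologicalSpace X] extends OpenCover X where
  order : PartialOrder ι
  total : ∀ (α β : ι) (x : X), x ∈ U α → x ∈ U β → α ≤ β ∨ β ≤ α

attribute [instance] OrderedOpenCover.order

section Cech

variable {X : Type u} [TopologicalSpace X]

namespace OpenCover

/-- The intersection of the members of a cover indexed by a tuple. -/
def inter (𝒰 : OpenCover X) {k : ℕ} (s : Fin k → 𝒰.ι) : Set X := {x | ∀ i, x ∈ 𝒰.U (s i)}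

/-- Čech `p`-cochains with coefficients in the constant sheaf `{±1}`, written multiplicatively. -/
abbrev Cochain (𝒰 : OpenCover X) (p : ℕ) : Type u :=
  ∀ s : Fin (p + 1) → 𝒰.ι, LocallyConstant (𝒰.inter s) ℤˣ

/-- The Čech differential
`(δ f)(s_0, …, s_(p+1)) = ∏_i f(s_0, …, ŝ_i, …, s_(p+1)) ^ ((-1) ^ i)`. -/
def δ (𝒰 : OpenCover X) {p : ℕ} (f : 𝒰.Cochain p) : 𝒰.Cochain (p + 1) := fun s =>
  ∏ i : Fin (p + 2),
    ((f (s ∘ i.succAbove)).comap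
      ⟨Set.inclusion fun _ (hx : ∀ k, _ ∈ 𝒰.U (s k)) j => hx (i.succAbove j),
        continuous_inclusion _⟩) ^
        ((-1 : ℤ) ^ (i : ℕ))

def IsCocycle (𝒰 : OpenCover X) {p : ℕ} (f : 𝒰.Cochain p) : Prop := 𝒰.δ f = 1

def IsCoboundary (𝒰 : OpenCover X) : ∀ {p : ℕ}, 𝒰.Cochain p → Prop
  | 0, f => f = 1
  | p + 1, f => ∃ h : 𝒰.Cochain p, 𝒰.δ h = f

/-- A refinement map `𝒱 → 𝒰`. -/
structure Refinement (𝒰 𝒱 : OpenCover X) where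
  map : 𝒱.ι → 𝒰.ι
  le : ∀ j, 𝒱.U j ≤ 𝒰.U (map j)

/-- Pullback of cochains along a refinement map. -/
def Refinement.pullback {𝒰 𝒱 : OpenCover X} (r : 𝒰.Refinement 𝒱) {p : ℕ} (f : 𝒰.Cochain p) :
    𝒱.Cochain p := fun s =>
  (f (r.map ∘ s)).comap ⟨Set.inclusion fun _ hx j => r.le (s j) (hx j), continuous_inclusion _⟩

end OpenCover

/-- The equivalence relation generated by this relation on the Čech `p`-cocycles of all covers of
`X` is the one that defines the colimit of the cohomology groups of the covers: a cocycle is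
related to everything that is cohomologous to its pullback to a refinement. -/
def CechRel (X : Type u) [TopologicalSpace X] (p : ℕ)
    (a b : Σ 𝒰 : OpenCover X, {f : 𝒰.Cochain p // 𝒰.IsCocycle f}) : Prop :=
  ∃ r : a.1.Refinement b.1, b.1.IsCoboundary (r.pullback a.2.1 * (b.2.1)⁻¹)

/-- Čech cohomology of `X` with coefficients in `{±1}`: the colimit, over all open covers and
refinement maps, of the cohomology of the Čech complexes. -/
def CechCohomology (X : Type u) [TopologicalSpace X] (p : ℕ) : Type (u + 1) :=
  Quot (CechRel X p)

/-- The class of a cocycle. -/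
def cechClass (𝒰 : OpenCover X) {p : ℕ} (f : 𝒰.Cochain p) (hf : 𝒰.IsCocycle f) :
    CechCohomology X p := Quot.mk _ ⟨𝒰, f, hf⟩

theorem OpenCover.isCocycle_one (𝒰 : OpenCover X) {p : ℕ} :
    𝒰.IsCocycle (1 : 𝒰.Cochain p) := by
  funext s
  refine Finset.prod_eq_one fun i _ => ?_
  refine LocallyConstant.ext fun x => ?_
  show (1 : ℤˣ) ^ ((-1 : ℤ) ^ (i : ℕ)) = 1
  exact one_zpow _

/-- The neutral element of Čech cohomology: the class of the trivial cocycle (on any cover). -/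
instance (p : ℕ) : One (CechCohomology X p) :=
  ⟨cechClass ⟨PUnit, fun _ => ⊤, fun _ => ⟨⟨⟩, trivial⟩⟩ 1 (OpenCover.isCocycle_one _)⟩

end Cech

/-! ### Smooth charted 2-vector bundles -/

section Bundles

variable {E : Type*} [NormedAddCommGroup E] [NormedSpace ℝ E] {H : Type*} [TopologicalSpace H]

/-- A map into a space of morphisms of `M_n(V)` is smooth if all matrix entries are smooth. -/
def SmoothMor (I : ModelWithCorners ℝ E H) {M : Type*} [TopologicalSpace M] [ChartedSpace H M]
    {A B : Obj n} (f : M → Mor A B) : Prop :=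
  ∀ (i j : Fin n) (p : Fin (B i j)) (q : Fin (A i j)),
    ContMDiff I 𝓘(ℝ, ℂ) ∞ fun x => f x i j (Pi.single q 1) p

/-- A smooth charted 2-vector bundle of rank `n` over `X`: a smooth principal `Gl_n(V)`-bundle.
The data on `U_α ∩ U_β` and on `U_α ∩ U_β ∩ U_γ` is meaningful only if this set is nonempty. -/
structure TwoVectorBundle (I : ModelWithCorners ℝ E H) (X : Type u) [TopologicalSpace X]
    [ChartedSpace H X] (n : ℕ) where
  cover : OrderedOpenCover X
  obj : ∀ {α β : cover.ι}, α < β → Obj n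
  weaklyInvertible : ∀ {α β : cover.ι} (hαβ : α < β), WeaklyInvertible (obj hαβ)
  obj_mul : ∀ {α β γ : cover.ι} (hαβ : α < β) (hβγ : β < γ),
    ((cover.U α ⊓ cover.U β ⊓ cover.U γ : Opens X) : Set X).Nonempty →
      obj hαβ * obj hβγ = obj (hαβ.trans hβγ)
  φ : ∀ {α β γ : cover.ι} (hαβ : α < β) (hβγ : β < γ),
    (cover.U α ⊓ cover.U β ⊓ cover.U γ : Opens X) →
      Mor (obj hαβ * obj hβγ) (obj (hαβ.trans hβγ))
  smooth : ∀ {α β γ : cover.ι} (hαβ : α < β) (hβγ : β < γ), SmoothMor I (φ hαβ hβγ)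
  coherent : ∀ {α β γ δ : cover.ι} (hαβ : α < β) (hβγ : β < γ) (hγδ : γ < δ) (x : X)
    (hα : x ∈ cover.U α) (hβ : x ∈ cover.U β) (hγ : x ∈ cover.U γ) (hδ : x ∈ cover.U δ),
    (assoc (obj hαβ) (obj hβγ) (obj hγδ)).comp
        (((φ hαβ hβγ ⟨x, ⟨hα, hβ⟩, hγ⟩).mul (Mor.id (obj hγδ))).comp
          (φ (hαβ.trans hβγ) hγδ ⟨x, ⟨hα, hγ⟩, hδ⟩)) =
      ((Mor.id (obj hαβ)).mul (φ hβγ hγδ ⟨x, ⟨hβ, hγ⟩, hδ⟩)).comp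
        (φ hαβ (hβγ.trans hγδ) ⟨x, ⟨hα, hβ⟩, hδ⟩)

/-- A smooth charted oriented 2-vector bundle of rank `n` over `X`: a smooth principal bundle for
the oriented version of `Gl_n(V)`. -/
structure OrientedTwoVectorBundle (I : ModelWithCorners ℝ E H) (X : Type u) [TopologicalSpace X]
    [ChartedSpace H X] (n : ℕ) where
  cover : OrderedOpenCover X
  obj : ∀ {α β : cover.ι}, α < β → Obj n
  weaklyInvertible : ∀ {α β : cover.ι} (hαβ : α < β), WeaklyInvertible (obj hαβ)
  obj_mul : ∀ {α β γ : cover.ι} (hαβ : α < β) (hβγ : β < γ),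
    ((cover.U α ⊓ cover.U β ⊓ cover.U γ : Opens X) : Set X).Nonempty →
      obj hαβ * obj hβγ = obj (hαβ.trans hβγ)
  φ : ∀ {α β γ : cover.ι} (hαβ : α < β) (hβγ : β < γ),
    (cover.U α ⊓ cover.U β ⊓ cover.U γ : Opens X) →
      OMor (obj hαβ * obj hβγ) (obj (hαβ.trans hβγ))
  smooth : ∀ {α β γ : cover.ι} (hαβ : α < β) (hβγ : β < γ),
    SmoothMor I (fun x => (φ hαβ hβγ x).1) ∧ IsLocallyConstant (fun x => (φ hαβ hβγ x).2)
  coherent : ∀ {α β γ δ : cover.ι} (hαβ : α < β) (hβγ : β < γ) (hγδ : γ < δ) (x : X)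
    (hα : x ∈ cover.U α) (hβ : x ∈ cover.U β) (hγ : x ∈ cover.U γ) (hδ : x ∈ cover.U δ),
    (oassoc (obj hαβ) (obj hβγ) (obj hγδ)).comp
        ((OMor.mul (φ hαβ hβγ ⟨x, ⟨hα, hβ⟩, hγ⟩) (OMor.id (obj hγδ))).comp
          (φ (hαβ.trans hβγ) hγδ ⟨x, ⟨hα, hγ⟩, hδ⟩)) =
      (OMor.mul (OMor.id (obj hαβ)) (φ hβγ hγδ ⟨x, ⟨hβ, hγ⟩, hδ⟩)).comp
        (φ hαβ (hβγ.trans hγδ) ⟨x, ⟨hα, hβ⟩, hδ⟩)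

variable {I : ModelWithCorners ℝ E H} {X : Type u} [TopologicalSpace X] [ChartedSpace H X]

/-- The image of an oriented bundle under the functor that forgets the signs. -/
def OrientedTwoVectorBundle.forget (𝓔 : OrientedTwoVectorBundle I X n) :
    TwoVectorBundle I X n where
  cover := 𝓔.cover
  obj := 𝓔.obj
  weaklyInvertible := 𝓔.weaklyInvertible
  obj_mul := 𝓔.obj_mul
  φ hαβ hβγ x := (𝓔.φ hαβ hβγ x).1
  smooth hαβ hβγ := (𝓔.smooth hαβ hβγ).1
  coherent hαβ hβγ hγδ x hα hβ hγ hδ :=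
    congrArg Prod.fst (𝓔.coherent hαβ hβγ hγδ x hα hβ hγ hδ)

namespace TwoVectorBundle

/-- The sign of the associator `α^{αβγδ}` for indices `α < β < γ < δ`. -/
def sgn (𝓔 : TwoVectorBundle I X n) {α β γ δ : 𝓔.cover.ι} (hαβ : α < β) (hβγ : β < γ)
    (hγδ : γ < δ) : ℤˣ :=
  assocSgn (𝓔.obj hαβ) (𝓔.obj hβγ) (𝓔.obj hγδ)

open Classical in
/-- The signs of the associators as an alternating Čech 3-cochain: on a 4-tuple that is a
permutation of a chain `α < β < γ < δ` the value is the sign for this chain (alternation does not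
change it, since the coefficients are `{±1}`); on all other 4-tuples, which have a repeated
entry or no common point, the value is trivial. -/
def sgnCochain (𝓔 : TwoVectorBundle I X n) : 𝓔.cover.toOpenCover.Cochain 3 := fun s =>
  if h : ∃ σ : Equiv.Perm (Fin 4), StrictMono (s ∘ σ) then
    LocallyConstant.const _
      (𝓔.sgn (h.choose_spec (show (0 : Fin 4) < 1 by decide))
        (h.choose_spec (show (1 : Fin 4) < 2 by decide))
        (h.choose_spec (show (2 : Fin 4) < 3 by decide)))
  else 1

/-- `𝓔.RestrictsTo t 𝓔'`: the restriction of the bundle `𝓔` over `X × [0,1]` to `X × {t} = X` is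
`𝓔'`. Restriction removes the members of the cover that do not meet `X × {t}`; empty members of
the cover of `𝓔'` are ignored likewise, and the indices may be renamed. -/
def RestrictsTo (𝓔 : TwoVectorBundle (I.prod (𝓡∂ 1)) (X × Set.Icc (0 : ℝ) 1) n)
    (t : Set.Icc (0 : ℝ) 1) (𝓔' : TwoVectorBundle I X n) : Prop :=
  ∃ e : {α : 𝓔'.cover.ι // ∃ x, x ∈ 𝓔'.cover.U α} ≃o
      {α : 𝓔.cover.ι // ∃ x, (x, t) ∈ 𝓔.cover.U α},
    (∀ α x, x ∈ 𝓔'.cover.U α.1 ↔ (x, t) ∈ 𝓔.cover.U (e α).1) ∧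
    (∀ α β (h : α < β) x, x ∈ 𝓔'.cover.U α.1 → x ∈ 𝓔'.cover.U β.1 →
      𝓔'.obj (show α.1 < β.1 from h) =
        𝓔.obj (show (e α).1 < (e β).1 from e.strictMono h)) ∧
    (∀ α β γ (h : α < β) (h' : β < γ) x
      (hx : x ∈ 𝓔'.cover.U α.1 ⊓ 𝓔'.cover.U β.1 ⊓ 𝓔'.cover.U γ.1)
      (hx' : (x, t) ∈ 𝓔.cover.U (e α).1 ⊓ 𝓔.cover.U (e β).1 ⊓ 𝓔.cover.U (e γ).1),
      HEq (𝓔'.φ (show α.1 < β.1 from h) (show β.1 < γ.1 from h') ⟨x, hx⟩)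
        (𝓔.φ (show (e α).1 < (e β).1 from e.strictMono h)
          (show (e β).1 < (e γ).1 from e.strictMono h') ⟨(x, t), hx'⟩))

/-- The coherency maps of a bundle over `X × [0,1]` are constant in the direction of `[0,1]` near
both ends. -/
def ConstantNearEnds (𝓔 : TwoVectorBundle (I.prod (𝓡∂ 1)) (X × Set.Icc (0 : ℝ) 1) n) : Prop :=
  ∃ ε > (0 : ℝ), ∀ {α β γ : 𝓔.cover.ι} (hαβ : α < β) (hβγ : β < γ) (x : X)
    (s t : Set.Icc (0 : ℝ) 1)
    (hs : (x, s) ∈ 𝓔.cover.U α ⊓ 𝓔.cover.U β ⊓ 𝓔.cover.U γ)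
    (ht : (x, t) ∈ 𝓔.cover.U α ⊓ 𝓔.cover.U β ⊓ 𝓔.cover.U γ),
    (s.1 < ε ∧ t.1 < ε) ∨ (1 - ε < s.1 ∧ 1 - ε < t.1) →
      𝓔.φ hαβ hβγ ⟨(x, s), hs⟩ = 𝓔.φ hαβ hβγ ⟨(x, t), ht⟩

/-- Equivalence (cobordism) of smooth charted 2-vector bundles. -/
def Equivalent (𝓔₀ 𝓔₁ : TwoVectorBundle I X n) : Prop :=
  ∃ 𝓔 : TwoVectorBundle (I.prod (𝓡∂ 1)) (X × Set.Icc (0 : ℝ) 1) n,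
    𝓔.ConstantNearEnds ∧ 𝓔.RestrictsTo 0 𝓔₀ ∧ 𝓔.RestrictsTo 1 𝓔₁

/-- A bundle is orientable if it is equivalent to one that underlies an oriented bundle. -/
def Orientable (𝓔 : TwoVectorBundle I X n) : Prop :=
  ∃ 𝓔' : OrientedTwoVectorBundle I X n, 𝓔.Equivalent 𝓔'.forget

end TwoVectorBundle

end Bundles

end TwoVect

end

/-!
The functor `Det` sends the pentagon for the associators of `M_n(V)` to an identity between signs.
The associators and unitors permute basis vectors, so only permutations have to be dealt with:
`Det` takes the monoidal product of two of them to the product in the ring `L_V`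
(`BasisMor.Det_mul`) and composition to composition (`BasisMor.Det_comp`). When the outer objects
have determinant `±1`, a product with their identity morphisms does not change a sign, and the
pentagon becomes the cocycle identity (`assocSgn_pentagon`). It holds on sorted 5-tuples of indices
and extends to all others, because the cochain is alternating (`prod_succAbove_eq`).

The class is an invariant of the equivalence class because Čech cohomology is homotopy invariant.
The sign cochain of a bundle over `X × [0,1]` depends on the indices only. By the tube lemma, over
a neighbourhood of each point of `X` members of the cover can be chosen that are piecewise constant
in the direction of `[0,1]` (`exists_stepPair`). At every jump the prism operator gives a homotopy
between the two choices, and the product over all jumps is a cochain whose differential relates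
the two ends (`exists_refinement_of_ends`). The number of jumps need not be bounded: the prism
operator is trivial where there is no jump, as the cochain is alternating, so that the product
over any tuple of indices is finite. No paracompactness enters.

In an oriented bundle the coherence condition for the signs says that they form a cochain with
the sign cochain as its differential (`OrientedTwoVectorBundle.δ_signCochain`). Conversely, a
cocycle with trivial class becomes a coboundary on some refinement of the cover
(`exists_isCoboundary_of_cechClass_eq_one`; two refinement maps induce cohomologous pullbacks,
again by the prism operator). A refinement map `r` orders the refined cover lexicographically, with
an arbitrary linear order on each fibre of `r`. The bundle restricts to the refined cover with the
unit object between indices in the same fibre and with unitors as coherency maps; the triangle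
identities give the coherence (`TwoVectorBundle.extφ_coherent`). The same construction over
`X × [0,1]`, with the members `U × [0,1)` and `V × (0,1]`, is a cobordism from the bundle to its
restriction (`TwoVectorBundle.equivalent_refine`). The unitors preserve the lexicographic order of
the basis vectors, hence are even, so associators with a unit object have sign `1` and the sign
cochain of the restriction is the pullback of the original one. A cochain that trivializes it
therefore orients the restriction (`TwoVectorBundle.orientedRefine`).
-/

noncomputable section

namespace TwoVect

variable {n : ℕ}

/-! ### Signs of bijections between standard bases -/

/-- The sign of a bijection `Fin a ≃ Fin b`; such a bijection forces `a = b`. -/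
def basisSign {a b : ℕ} (σ : Fin a ≃ Fin b) : ℤˣ :=
  Equiv.Perm.sign (σ.trans (finCongr (Fin.equiv_iff_eq.mp ⟨σ⟩).symm))

theorem basisSign_perm {a : ℕ} (σ : Fin a ≃ Fin a) : basisSign σ = Equiv.Perm.sign σ := rfl

theorem basisSign_trans {a b c : ℕ} (σ : Fin a ≃ Fin b) (τ : Fin b ≃ Fin c) :
    basisSign (σ.trans τ) = basisSign σ * basisSign τ := by
  obtain rfl : a = b := Fin.equiv_iff_eq.mp ⟨σ⟩
  obtain rfl : a = c := Fin.equiv_iff_eq.mp ⟨τ⟩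
  simp only [basisSign_perm, Equiv.Perm.sign_trans, mul_comm]

theorem basisSign_of_strictMono {a b : ℕ} (σ : Fin a ≃ Fin b) (h : StrictMono σ) :
    basisSign σ = 1 := by
  obtain rfl : a = b := Fin.equiv_iff_eq.mp ⟨σ⟩
  have : (h.orderIsoOfSurjective σ σ.surjective) = OrderIso.refl _ := Subsingleton.elim _ _
  have h2 : σ = Equiv.refl _ := by
    ext x
    exact congrArg Fin.val (DFunLike.congr_fun this x)
  rw [basisSign_perm, h2, Equiv.Perm.sign_refl]

/-- The embedding of the signs into the automorphisms of `ℂ`. -/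
abbrev signUnit : ℤˣ →* ℂˣ := Units.map (Int.castRingHom ℂ).toMonoidHom

theorem signUnit_injective : Function.Injective signUnit := by
  intro s t h
  have h' : ((s : ℤ) : ℂ) = ((t : ℤ) : ℂ) := congrArg Units.val h
  exact Units.ext (by exact_mod_cast h')

theorem VHom.det_ofEquiv {a b : ℕ} (σ : Fin a ≃ Fin b) :
    (VHom.ofEquiv σ).det = signUnit (basisSign σ) := by
  obtain rfl : a = b := (VHom.ofEquiv σ).eq
  have h : (VHom.ofEquiv σ).trans (VHom.ofEquiv (finCongr (VHom.ofEquiv σ).eq.symm))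
      = VHom.ofEquiv σ := by
    ext v p
    rfl
  have h2 : ((VHom.ofEquiv σ : VHom a a) : (Fin a → ℂ) →ₗ[ℂ] (Fin a → ℂ))
      = Matrix.toLin' (Equiv.Perm.permMatrix ℂ σ.symm) := by
    refine LinearMap.ext fun v => funext fun p => ?_
    simp [VHom.ofEquiv, Equiv.Perm.permMatrix, LinearMap.funLeft,
      PEquiv.toMatrix_toPEquiv_mulVec]
  unfold VHom.det
  rw [h]
  refine Units.ext ?_
  rw [LinearEquiv.coe_det, h2, LinearMap.det_toLin', Matrix.det_permutation,
    Equiv.Perm.sign_symm, basisSign_perm]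
  rfl

theorem sign_sigmaCongrRight {ι : Type*} [DecidableEq ι] [Fintype ι] {β : ι → Type*}
    [∀ i, DecidableEq (β i)] [∀ i, Fintype (β i)] (σ : ∀ i, Equiv.Perm (β i)) :
    Equiv.Perm.sign (Equiv.sigmaCongrRight σ) = ∏ i, Equiv.Perm.sign (σ i) := by
  let g : (∀ i, Equiv.Perm (β i)) →* ℤˣ :=
    { toFun := fun σ => ∏ i, Equiv.Perm.sign (σ i)
      map_one' := by simp
      map_mul' := fun σ τ => by simp [Finset.prod_mul_distrib] }
  have key : (Equiv.Perm.sign.comp (Equiv.Perm.sigmaCongrRightHom β)) = g := by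
    refine MonoidHom.pi_ext fun i τ => ?_
    have hg : g (Pi.mulSingle i τ) = Equiv.Perm.sign τ := by
      refine (Finset.prod_eq_single i (fun j _ hj => ?_)
        (fun h => absurd (Finset.mem_univ _) h)).trans ?_
      · simp [Pi.mulSingle_eq_of_ne hj]
      · simp
    rw [hg]
    symm
    refine Equiv.Perm.sign_bij (fun x _ => ⟨i, x⟩) ?_ ?_ ?_
    · intro x hx hx'
      simp
    · intro x y _ _ h
      simpa using h
    · rintro ⟨j, y⟩ hy
      by_cases hj : j = i
      · subst hj
        refine ⟨y, fun h => hy ?_, rfl⟩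
        simpa using h
      · refine absurd ?_ hy
        simp [Pi.mulSingle_eq_of_ne hj]
  exact DFunLike.congr_fun key σ

theorem sign_prodCongr {α β : Type*} [DecidableEq α] [Fintype α] [DecidableEq β] [Fintype β]
    (σ : Equiv.Perm α) (τ : Equiv.Perm β) :
    Equiv.Perm.sign (Equiv.prodCongr σ τ) =
      Equiv.Perm.sign σ ^ Fintype.card β * Equiv.Perm.sign τ ^ Fintype.card α := by
  have h : Equiv.prodCongr σ τ =
      (Equiv.prodCongrLeft fun _ : β => σ) * (Equiv.prodCongrRight fun _ : α => τ) := by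
    ext ⟨a, b⟩ <;> rfl
  rw [h, Equiv.Perm.sign_mul, Equiv.Perm.sign_prodCongrLeft, Equiv.Perm.sign_prodCongrRight]
  simp

/-! ### Morphisms that permute the standard bases -/

/-- Families of bijections between the standard bases of the entries of two objects. -/
abbrev BasisMor (A B : Obj n) : Type := ∀ i j, Fin (A i j) ≃ Fin (B i j)

theorem BasisMor.eq {A B : Obj n} (σ : BasisMor A B) : A = B :=
  Matrix.ext fun i j => Fin.equiv_iff_eq.mp ⟨σ i j⟩

/-- The morphism of `M_n(V)` that permutes the basis vectors. -/
def BasisMor.toMor {A B : Obj n} (σ : BasisMor A B) : Mor A B := fun i j => VHom.ofEquiv (σ i j)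

/-- The identity of an object, as a family of bijections of bases. -/
def BasisMor.id (A : Obj n) : BasisMor A A := fun _ _ => Equiv.refl _

/-- Composition of families of bijections (first `σ`, then `τ`). -/
def BasisMor.comp {A B C : Obj n} (σ : BasisMor A B) (τ : BasisMor B C) : BasisMor A C :=
  fun i j => (σ i j).trans (τ i j)

/-- The monoidal product of families of bijections: `e_a ⊗ e_b ↦ e_(σ a) ⊗ e_(τ b)` in each
summand. -/
def BasisMor.mul {A A' B B' : Obj n} (σ : BasisMor A A') (τ : BasisMor B B') :
    BasisMor (A * B) (A' * B') := fun i k =>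
  (mulIndex A B i k).trans
    ((Equiv.sigmaCongrRight fun j => (σ i j).prodCongr (τ j k)).trans (mulIndex A' B' i k).symm)

/-- The basis vector `e_a ⊗ e_b` in the `j`-th summand of `⊕_j A i j ⊗ B j k`. -/
def tensorIndex (A B : Obj n) {i j k : Fin n} (a : Fin (A i j)) (b : Fin (B j k)) :
    Fin ((A * B) i k) := (mulIndex A B i k).symm ⟨j, a, b⟩

theorem exists_tensorIndex {A B : Obj n} {i k : Fin n} (p : Fin ((A * B) i k)) :
    ∃ (j : Fin n) (a : Fin (A i j)) (b : Fin (B j k)), p = tensorIndex A B a b :=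
  ⟨_, _, _, ((mulIndex A B i k).symm_apply_apply p).symm⟩

@[simp] theorem mulIndex_tensorIndex (A B : Obj n) {i j k : Fin n} (a : Fin (A i j))
    (b : Fin (B j k)) : mulIndex A B i k (tensorIndex A B a b) = ⟨j, a, b⟩ :=
  Equiv.apply_symm_apply _ _

theorem mulIndex_symm_mk (A B : Obj n) {i j k : Fin n} (a : Fin (A i j))
    (b : Fin (B j k)) : (mulIndex A B i k).symm ⟨j, a, b⟩ = tensorIndex A B a b := rfl

@[simp] theorem BasisMor.mul_tensorIndex {A A' B B' : Obj n} (σ : BasisMor A A')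
    (τ : BasisMor B B') {i j k : Fin n} (a : Fin (A i j)) (b : Fin (B j k)) :
    σ.mul τ i k (tensorIndex A B a b) = tensorIndex A' B' (σ i j a) (τ j k b) := by
  simp [BasisMor.mul, mulIndex_symm_mk]

@[simp] theorem assocIndex_tensorIndex (A B C : Obj n) {i j k l : Fin n} (a : Fin (A i j))
    (b : Fin (B j k)) (c : Fin (C k l)) :
    assocIndex A B C i l (tensorIndex A (B * C) a (tensorIndex B C b c)) =
      tensorIndex (A * B) C (tensorIndex A B a b) c := by
  simp only [assocIndex, Equiv.trans_apply, mulIndex_tensorIndex, Equiv.symm_trans_apply]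
  simp only [Equiv.sigmaCongrRight_apply, Equiv.prodCongrRight_apply, mulIndex_tensorIndex]
  rfl

/-- The associator as a family of bijections of bases. -/
def basisAssoc (A B C : Obj n) : BasisMor (A * (B * C)) (A * B * C) := assocIndex A B C

theorem basisAssoc_toMor (A B C : Obj n) : (basisAssoc A B C).toMor = assoc A B C := rfl

/-- The pentagon for the associators of `M_n(V)`. -/
theorem basis_pentagon (A B C D : Obj n) :
    (basisAssoc A B (C * D)).comp (basisAssoc (A * B) C D) =
      ((BasisMor.id A).mul (basisAssoc B C D)).comp
        ((basisAssoc A (B * C) D).comp ((basisAssoc A B C).mul (BasisMor.id D))) := by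
  funext i m
  refine Equiv.ext fun p => ?_
  obtain ⟨j, a, p, rfl⟩ := exists_tensorIndex p
  obtain ⟨k, b, p, rfl⟩ := exists_tensorIndex p
  obtain ⟨l, c, d, rfl⟩ := exists_tensorIndex p
  simp [BasisMor.comp, basisAssoc, BasisMor.id]

/-! ### `Det` on permutations of basis vectors -/

theorem LV.sum_mor {ι : Type*} (s : Finset ι) (f : ι → LV) :
    (∑ i ∈ s, f i).mor = ∏ i ∈ s, (f i).mor := by
  classical
  induction s using Finset.induction_on with
  | empty => rfl
  | insert a s ha ih => rw [Finset.sum_insert ha, Finset.prod_insert ha, LV.add_mor, ih]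

theorem LV.sum_obj {ι : Type*} (s : Finset ι) (f : ι → LV) :
    (∑ i ∈ s, f i).obj = ∑ i ∈ s, (f i).obj := by
  classical
  induction s using Finset.induction_on with
  | empty => rfl
  | insert a s ha ih => rw [Finset.sum_insert ha, Finset.sum_insert ha, LV.add_obj, ih]

/-- `Λ_*` takes the monoidal product to the product of matrices over `L_V`: this is
`det (φ ⊗ ψ) = det φ ^ (dim ψ) det ψ ^ (dim φ)`. -/
theorem BasisMor.lambda_mul {A A' B B' : Obj n} (σ : BasisMor A A') (τ : BasisMor B B') :
    (σ.mul τ).toMor.lambda = σ.toMor.lambda * τ.toMor.lambda := by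
  obtain rfl := σ.eq
  obtain rfl := τ.eq
  ext i k : 1
  · rw [Matrix.mul_apply]
    refine LV.ext ?_ ?_
    · rw [LV.sum_obj]
      simp [Mor.lambda, Matrix.mul_apply]
    · rw [LV.sum_mor]
      show (VHom.ofEquiv _).det = _
      rw [VHom.det_ofEquiv, basisSign_perm]
      have h : Equiv.Perm.sign (σ.mul τ i k) =
          Equiv.Perm.sign (Equiv.sigmaCongrRight fun j => (σ i j).prodCongr (τ j k)) :=
        Equiv.Perm.sign_trans_trans_symm
          (Equiv.sigmaCongrRight fun j => (σ i j).prodCongr (τ j k)) (mulIndex A B i k)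
      rw [h, sign_sigmaCongrRight, map_prod]
      refine Finset.prod_congr rfl fun j _ => ?_
      rw [sign_prodCongr]
      simp only [Mor.lambda, BasisMor.toMor, LV.mul_mor, Matrix.of_apply, VHom.det_ofEquiv,
        basisSign_perm, Fintype.card_fin, map_mul, map_pow, zpow_natCast]

/-- The pairs of morphisms of `L_V` with the same object. -/
def LV.pairs : Subring (LV × LV) where
  carrier := {p | p.1.obj = p.2.obj}
  mul_mem' {a b} (ha : _ = _) (hb : _ = _) := by simp [ha, hb]
  one_mem' := rfl
  add_mem' {a b} (ha : _ = _) (hb : _ = _) := by simp [ha, hb]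
  zero_mem' := rfl
  neg_mem' {a} (ha : _ = _) := by simp [ha]

/-- Composition in `L_V` is a ring homomorphism, since `⊕` and `⊗` are functors. -/
def LV.compHom : LV.pairs →+* LV where
  toFun p := ⟨p.1.1.obj, p.1.1.mor * p.1.2.mor⟩
  map_one' := by ext <;> simp
  map_zero' := by ext <;> simp
  map_add' p q := by
    refine LV.ext (by simp) ?_
    simp only [Subring.coe_add, Prod.fst_add, Prod.snd_add, LV.add_mor]
    exact mul_mul_mul_comm _ _ _ _
  map_mul' p q := by
    refine LV.ext (by simp) ?_
    have hp : p.1.1.obj = p.1.2.obj := p.2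
    have hq : q.1.1.obj = q.1.2.obj := q.2
    simp only [Subring.coe_mul, Prod.fst_mul, Prod.snd_mul, LV.mul_mor, mul_zpow, hp, hq]
    exact mul_mul_mul_comm _ _ _ _

/-- The determinant over `L_V` is a functor: it takes entrywise composition to composition. -/
theorem LV.det_mor_mul (M N : Matrix (Fin n) (Fin n) LV) (h : ∀ i j, (M i j).obj = (N i j).obj) :
    (Matrix.of fun i j => (⟨(M i j).obj, (M i j).mor * (N i j).mor⟩ : LV)).det.mor =
      M.det.mor * N.det.mor := by
  let P : Matrix (Fin n) (Fin n) LV.pairs := Matrix.of fun i j => ⟨(M i j, N i j), h i j⟩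
  have h1 : ((RingHom.fst LV LV).comp LV.pairs.subtype) P.det = M.det := by
    rw [RingHom.map_det]; rfl
  have h2 : ((RingHom.snd LV LV).comp LV.pairs.subtype) P.det = N.det := by
    rw [RingHom.map_det]; rfl
  have h3 : LV.compHom P.det =
      (Matrix.of fun i j => (⟨(M i j).obj, (M i j).mor * (N i j).mor⟩ : LV)).det := by
    rw [RingHom.map_det]; rfl
  rw [← h1, ← h2, ← h3]
  rfl

/-- The projection of `L_V` to the ring of objects. -/
def LV.objHom : LV →+* ℤ where
  toFun := LV.obj
  map_one' := rfl
  map_zero' := rfl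
  map_add' _ _ := rfl
  map_mul' _ _ := rfl

theorem Mor.Det_obj {A B : Obj n} (φ : Mor A B) : φ.Det.obj = objDet A := by
  have : LV.objHom φ.Det = objDet A := by
    unfold Mor.Det objDet
    rw [RingHom.map_det]; rfl
  exact this

theorem BasisMor.Det_comp {A B C : Obj n} (σ : BasisMor A B) (τ : BasisMor B C) :
    (σ.comp τ).toMor.Det.mor = σ.toMor.Det.mor * τ.toMor.Det.mor := by
  obtain rfl := σ.eq
  unfold Mor.Det
  refine Eq.trans ?_ (LV.det_mor_mul _ _ fun _ _ => rfl)
  congr 2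
  ext i j : 1
  · refine LV.ext rfl ?_
    show (VHom.ofEquiv _).det = (VHom.ofEquiv _).det * (VHom.ofEquiv _).det
    simp only [VHom.det_ofEquiv, BasisMor.comp, basisSign_trans, map_mul]

theorem BasisMor.Det_mul {A A' B B' : Obj n} (σ : BasisMor A A') (τ : BasisMor B B') :
    (σ.mul τ).toMor.Det.mor =
      σ.toMor.Det.mor ^ objDet B * τ.toMor.Det.mor ^ objDet A := by
  conv_lhs => rw [Mor.Det, lambda_mul, Matrix.det_mul, LV.mul_mor]
  rw [← Mor.Det_obj τ.toMor, ← Mor.Det_obj σ.toMor]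
  rfl

/-- If every bijection is even, `Det` is trivial. -/
theorem BasisMor.Det_eq_one {A B : Obj n} (σ : BasisMor A B)
    (h : ∀ i j, basisSign (σ i j) = 1) : σ.toMor.Det.mor = 1 := by
  have : σ.toMor.lambda = LV.incl.mapMatrix (A.map (Nat.cast : ℕ → ℤ)) := by
    ext i j : 1
    refine LV.ext rfl ?_
    show (VHom.ofEquiv _).det = _
    rw [VHom.det_ofEquiv, h, map_one]
    rfl
  rw [Mor.Det, this, ← RingHom.map_det]
  rfl

theorem basisSign_refl (a : ℕ) : basisSign (Equiv.refl (Fin a)) = 1 := Equiv.Perm.sign_refl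

theorem BasisMor.Det_id (A : Obj n) : (BasisMor.id A).toMor.Det.mor = 1 :=
  BasisMor.Det_eq_one _ fun _ _ => basisSign_refl _

/-! ### The signs of the associators -/

theorem signUnit_assocSgn (A B C : Obj n) :
    signUnit (assocSgn A B C) = (basisAssoc A B C).toMor.Det.mor := by
  have h := (Det_assoc A B C).choose_spec
  exact (congrArg LV.mor h).symm

theorem units_zpow_of_isUnit (s : ℤˣ) {m : ℤ} (hm : IsUnit m) : s ^ m = s := by
  rcases Int.isUnit_iff.mp hm with rfl | rfl <;> simp

/-- The cocycle identity for the signs of the associators: the functor `Det`, applied to the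
pentagon. The outer factors have determinant `±1`, so that the product with their identity
morphisms does not change a sign. -/
theorem assocSgn_pentagon (A B C D : Obj n) (hA : WeaklyInvertible A) (hD : WeaklyInvertible D) :
    assocSgn A B (C * D) * assocSgn (A * B) C D =
      assocSgn B C D * (assocSgn A (B * C) D * assocSgn A B C) := by
  refine signUnit_injective ?_
  have h := congrArg (fun σ => σ.toMor.Det.mor) (basis_pentagon A B C D)
  simp only [BasisMor.Det_comp, BasisMor.Det_mul, BasisMor.Det_id, one_zpow, one_mul, mul_one,
    ← signUnit_assocSgn, ← map_zpow, units_zpow_of_isUnit _ hA,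
    units_zpow_of_isUnit _ hD] at h
  simpa only [map_mul] using h

/-! ### Units -/

/-- The basis vector of a diagonal entry of a unit object `Z`. The unit object is given by an
equation, so that objects equal to it need not be rewritten in types. -/
def unitIndex {Z : Obj n} (hZ : Z = 1) (i : Fin n) : Fin (Z i i) :=
  ⟨0, by rw [hZ, Matrix.one_apply_eq]; exact one_pos⟩

theorem exists_eq_unitIndex {Z : Obj n} (hZ : Z = 1) {i j : Fin n} (z : Fin (Z i j)) :
    ∃ h : i = j, z = h ▸ unitIndex hZ i := by
  subst hZ
  by_cases h : i = j
  · subst h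
    refine ⟨rfl, Fin.ext ?_⟩
    have := z.2.trans_eq (Matrix.one_apply_eq i)
    simpa [unitIndex] using this
  · exact absurd (z.2.trans_eq (Matrix.one_apply_ne h)) (Nat.not_lt_zero _)

/-- The left unitor, as a family of bijections of bases. -/
def basisLeftUnitor {Z : Obj n} (hZ : Z = 1) (A : Obj n) : BasisMor (Z * A) A := fun i k =>
  (Equiv.ofBijective (fun a : Fin (A i k) => tensorIndex Z A (unitIndex hZ i) a) ⟨fun a b h => by
      have := congrArg (mulIndex Z A i k) h
      simpa using this, fun p => by
      obtain ⟨j, z, a, rfl⟩ := exists_tensorIndex p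
      obtain ⟨rfl, rfl⟩ := exists_eq_unitIndex hZ z
      exact ⟨a, rfl⟩⟩).symm

/-- The right unitor, as a family of bijections of bases. -/
def basisRightUnitor {Z : Obj n} (hZ : Z = 1) (A : Obj n) : BasisMor (A * Z) A := fun i k =>
  (Equiv.ofBijective (fun a : Fin (A i k) => tensorIndex A Z a (unitIndex hZ k)) ⟨fun a b h => by
      have := congrArg (mulIndex A Z i k) h
      simpa using this, fun p => by
      obtain ⟨j, a, z, rfl⟩ := exists_tensorIndex p
      obtain ⟨rfl, rfl⟩ := exists_eq_unitIndex hZ z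
      exact ⟨a, rfl⟩⟩).symm

theorem basisLeftUnitor_symm {Z : Obj n} (hZ : Z = 1) (A : Obj n) {i k : Fin n} (a : Fin (A i k)) :
    (basisLeftUnitor hZ A i k).symm a = tensorIndex Z A (unitIndex hZ i) a := rfl

theorem basisRightUnitor_symm {Z : Obj n} (hZ : Z = 1) (A : Obj n) {i k : Fin n}
    (a : Fin (A i k)) :
    (basisRightUnitor hZ A i k).symm a = tensorIndex A Z a (unitIndex hZ k) := rfl

@[simp] theorem basisLeftUnitor_tensorIndex {Z : Obj n} (hZ : Z = 1) (A : Obj n) {i k : Fin n}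
    (a : Fin (A i k)) :
    basisLeftUnitor hZ A i k (tensorIndex Z A (unitIndex hZ i) a) = a := by
  rw [← basisLeftUnitor_symm, Equiv.apply_symm_apply]

@[simp] theorem basisRightUnitor_tensorIndex {Z : Obj n} (hZ : Z = 1) (A : Obj n) {i k : Fin n}
    (a : Fin (A i k)) :
    basisRightUnitor hZ A i k (tensorIndex A Z a (unitIndex hZ k)) = a := by
  rw [← basisRightUnitor_symm, Equiv.apply_symm_apply]

theorem tensorIndex_val (A B : Obj n) {i j k : Fin n} (a : Fin (A i j)) (b : Fin (B j k)) :
    (tensorIndex A B a b : ℕ) = (∑ j' : Fin j, A i (Fin.castLE j.2.le j') *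
      B (Fin.castLE j.2.le j') k) + (b + B j k * a) := by
  simp only [tensorIndex, mulIndex, Equiv.symm_trans_apply, Equiv.symm_symm]
  exact finSigmaFinEquiv_apply (⟨j, finProdFinEquiv (a, b)⟩ :
    Σ j : Fin n, Fin (A i j * B j k))

theorem basisSign_symm_of_strictMono {a b : ℕ} (σ : Fin a ≃ Fin b) (h : StrictMono σ.symm) :
    basisSign σ = 1 := by
  have h1 := basisSign_trans σ σ.symm
  rw [basisSign_of_strictMono _ h, Equiv.self_trans_symm, basisSign_refl, mul_one] at h1
  exact h1.symm

/-- In the lexicographic order of bases, the unitors are order preserving. -/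
theorem basisSign_leftUnitor {Z : Obj n} (hZ : Z = 1) (A : Obj n) (i k : Fin n) :
    basisSign (basisLeftUnitor hZ A i k) = 1 := by
  refine basisSign_symm_of_strictMono _ fun a b h => ?_
  rw [basisLeftUnitor_symm, basisLeftUnitor_symm, Fin.lt_def, tensorIndex_val, tensorIndex_val]
  have : (a : ℕ) < b := h
  lia

theorem basisSign_rightUnitor {Z : Obj n} (hZ : Z = 1) (A : Obj n) (i k : Fin n) :
    basisSign (basisRightUnitor hZ A i k) = 1 := by
  refine basisSign_symm_of_strictMono _ fun a b h => ?_
  rw [basisRightUnitor_symm, basisRightUnitor_symm, Fin.lt_def, tensorIndex_val, tensorIndex_val]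
  have : (a : ℕ) < b := h
  have hk : Z k k = 1 := by rw [hZ, Matrix.one_apply_eq]
  have hlt : Z k k * (a : ℕ) < Z k k * (b : ℕ) := Nat.mul_lt_mul_of_pos_left this (by lia)
  lia

theorem basis_triangle_left {Z : Obj n} (hZ : Z = 1) (B C : Obj n) :
    (basisAssoc Z B C).comp ((basisLeftUnitor hZ B).mul (BasisMor.id C)) =
      basisLeftUnitor hZ (B * C) := by
  funext i m
  refine Equiv.ext fun p => ?_
  obtain ⟨j, z, p, rfl⟩ := exists_tensorIndex p
  obtain ⟨k, b, c, rfl⟩ := exists_tensorIndex p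
  obtain ⟨rfl, rfl⟩ := exists_eq_unitIndex hZ z
  simp [BasisMor.comp, basisAssoc, BasisMor.id]

theorem basis_triangle_middle {Z : Obj n} (hZ : Z = 1) (A C : Obj n) :
    (basisAssoc A Z C).comp ((basisRightUnitor hZ A).mul (BasisMor.id C)) =
      (BasisMor.id A).mul (basisLeftUnitor hZ C) := by
  funext i m
  refine Equiv.ext fun p => ?_
  obtain ⟨j, a, p, rfl⟩ := exists_tensorIndex p
  obtain ⟨k, z, c, rfl⟩ := exists_tensorIndex p
  obtain ⟨rfl, rfl⟩ := exists_eq_unitIndex hZ z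
  simp [BasisMor.comp, basisAssoc, BasisMor.id]

theorem basis_triangle_right {Z : Obj n} (hZ : Z = 1) (A B : Obj n) :
    (basisAssoc A B Z).comp (basisRightUnitor hZ (A * B)) =
      (BasisMor.id A).mul (basisRightUnitor hZ B) := by
  funext i m
  refine Equiv.ext fun p => ?_
  obtain ⟨j, a, p, rfl⟩ := exists_tensorIndex p
  obtain ⟨k, b, z, rfl⟩ := exists_tensorIndex p
  obtain ⟨rfl, rfl⟩ := exists_eq_unitIndex hZ z
  simp [BasisMor.comp, basisAssoc, BasisMor.id]

theorem Det_leftUnitor {Z : Obj n} (hZ : Z = 1) (A : Obj n) :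
    (basisLeftUnitor hZ A).toMor.Det.mor = 1 :=
  BasisMor.Det_eq_one _ (basisSign_leftUnitor hZ A)

theorem Det_rightUnitor {Z : Obj n} (hZ : Z = 1) (A : Obj n) :
    (basisRightUnitor hZ A).toMor.Det.mor = 1 :=
  BasisMor.Det_eq_one _ (basisSign_rightUnitor hZ A)

theorem assocSgn_one_left {Z : Obj n} (hZ : Z = 1) (B C : Obj n) : assocSgn Z B C = 1 := by
  refine signUnit_injective ?_
  have h := congrArg (fun σ => σ.toMor.Det.mor) (basis_triangle_left hZ B C)
  simp only [BasisMor.Det_comp, BasisMor.Det_mul, BasisMor.Det_id, one_zpow, mul_one,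
    ← signUnit_assocSgn, Det_leftUnitor] at h
  rw [h, map_one]

theorem assocSgn_one_middle {Z : Obj n} (hZ : Z = 1) (A C : Obj n) : assocSgn A Z C = 1 := by
  refine signUnit_injective ?_
  have h := congrArg (fun σ => σ.toMor.Det.mor) (basis_triangle_middle hZ A C)
  simp only [BasisMor.Det_comp, BasisMor.Det_mul, BasisMor.Det_id, one_zpow, mul_one,
    ← signUnit_assocSgn, Det_leftUnitor, Det_rightUnitor] at h
  rw [h, map_one]

theorem assocSgn_one_right {Z : Obj n} (hZ : Z = 1) (A B : Obj n) : assocSgn A B Z = 1 := by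
  refine signUnit_injective ?_
  have h := congrArg (fun σ => σ.toMor.Det.mor) (basis_triangle_right hZ A B)
  simp only [BasisMor.Det_comp, BasisMor.Det_mul, BasisMor.Det_id, one_zpow, mul_one,
    ← signUnit_assocSgn, Det_rightUnitor] at h
  rw [h, map_one]

/-! ### Coordinates of monoidal products of morphisms -/

/-- The matrix of `φ ⬝ ψ`: Kronecker products of the matrices of the factors. -/
theorem Mor.mul_apply {A A' B B' : Obj n} (φ : Mor A A') (ψ : Mor B B') {i j k : Fin n}
    (v : Fin ((A * B) i k) → ℂ) (a' : Fin (A' i j)) (b' : Fin (B' j k)) :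
    Mor.mul φ ψ i k v (tensorIndex A' B' a' b') =
      ∑ x : Fin (A i j) × Fin (B j k), v (tensorIndex A B x.1 x.2) *
        (φ i j (Pi.single x.1 1) a' * ψ j k (Pi.single x.2 1) b') := by
  have h1 : ∀ w : ∀ j : Fin n, (Fin (A' i j) → ℂ) ⊗[ℂ] (Fin (B' j k) → ℂ),
      (mulSplit A' B' i k).symm w (tensorIndex A' B' a' b') =
        ((Pi.basisFun ℂ (Fin (A' i j))).tensorProduct (Pi.basisFun ℂ (Fin (B' j k)))).equivFun
          (w j) (a', b') := by
    intro w
    have : ∀ p, (mulSplit A' B' i k).symm w p =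
        ((Pi.basisFun ℂ (Fin (A' i (mulIndex A' B' i k p).1))).tensorProduct
          (Pi.basisFun ℂ (Fin (B' (mulIndex A' B' i k p).1 k)))).equivFun
          (w (mulIndex A' B' i k p).1) (mulIndex A' B' i k p).2 := fun p => rfl
    rw [this, mulIndex_tensorIndex]
  have h2 : mulSplit A B i k v j = ∑ x : Fin (A i j) × Fin (B j k),
      v (tensorIndex A B x.1 x.2) •
        ((Pi.single x.1 1 : Fin (A i j) → ℂ) ⊗ₜ[ℂ] (Pi.single x.2 1 : Fin (B j k) → ℂ)) := by
    have : mulSplit A B i k v j =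
        ((Pi.basisFun ℂ (Fin (A i j))).tensorProduct
          (Pi.basisFun ℂ (Fin (B j k)))).equivFun.symm
            (fun x => v (tensorIndex A B x.1 x.2)) := rfl
    rw [this, Module.Basis.equivFun_symm_apply]
    refine Finset.sum_congr rfl fun x _ => ?_
    rw [Module.Basis.tensorProduct_apply', Pi.basisFun_apply, Pi.basisFun_apply]
  have h3 : Mor.mul φ ψ i k v = (mulSplit A' B' i k).symm
      (fun j => TensorProduct.congr (φ i j) (ψ j k) (mulSplit A B i k v j)) := rfl
  rw [h3, h1, h2, map_sum, map_sum, Finset.sum_apply]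
  refine Finset.sum_congr rfl fun x _ => ?_
  rw [map_smul, map_smul, Pi.smul_apply, TensorProduct.congr_tmul, Module.Basis.equivFun_apply,
    Module.Basis.tensorProduct_repr_tmul_apply]
  simp [mul_comm]

theorem Mor.ext_apply {A B : Obj n} {φ ψ : Mor A B} (h : ∀ i j v p, φ i j v p = ψ i j v p) :
    φ = ψ := by
  funext i j
  exact LinearEquiv.ext fun v => funext fun p => h i j v p

theorem BasisMor.toMor_apply {A B : Obj n} (σ : BasisMor A B) (i j : Fin n) (v : Fin (A i j) → ℂ)
    (p : Fin (B i j)) : σ.toMor i j v p = v ((σ i j).symm p) := rfl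

theorem BasisMor.toMor_id (A : Obj n) : (BasisMor.id A).toMor = Mor.id A := rfl

theorem BasisMor.toMor_comp {A B C : Obj n} (σ : BasisMor A B) (τ : BasisMor B C) :
    (σ.comp τ).toMor = σ.toMor.comp τ.toMor := rfl

theorem BasisMor.toMor_mul {A A' B B' : Obj n} (σ : BasisMor A A') (τ : BasisMor B B') :
    (σ.mul τ).toMor = σ.toMor.mul τ.toMor := by
  refine Mor.ext_apply fun i k v p => ?_
  obtain ⟨j, a, b, rfl⟩ := exists_tensorIndex p
  obtain ⟨a, rfl⟩ := (σ i j).surjective a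
  obtain ⟨b, rfl⟩ := (τ j k).surjective b
  rw [Mor.mul_apply, BasisMor.toMor_apply, ← BasisMor.mul_tensorIndex, Equiv.symm_apply_apply,
    Finset.sum_eq_single (a, b)]
  · simp [BasisMor.toMor_apply]
  · rintro ⟨a', b'⟩ - h
    by_cases ha : a' = a
    · have hb : b ≠ b' := fun hb => h (by rw [ha, hb])
      simp [BasisMor.toMor_apply, hb]
    · simp [BasisMor.toMor_apply, Ne.symm ha]
  · intro h
    exact absurd (Finset.mem_univ _) h

theorem Mor.comp_apply {A B C : Obj n} (φ : Mor A B) (ψ : Mor B C) (i j : Fin n)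
    (v : Fin (A i j) → ℂ) : φ.comp ψ i j v = ψ i j (φ i j v) := rfl

theorem VHom.apply_eq_sum {a b : ℕ} (f : VHom a b) (v : Fin a → ℂ) (p : Fin b) :
    f v p = ∑ q, v q * f (Pi.single q 1) p := by
  conv_lhs => rw [← Finset.univ_sum_single v]
  rw [map_sum, Finset.sum_apply]
  refine Finset.sum_congr rfl fun q _ => ?_
  have : (Pi.single q (v q) : Fin a → ℂ) = v q • Pi.single q 1 := by
    rw [← Pi.single_smul]; simp
  rw [this, map_smul, Pi.smul_apply, smul_eq_mul]

/-! ### Unitors -/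

/-- The left unitor `Z ⬝ A → A`, for the unit object `Z`. -/
def leftUnitor {Z : Obj n} (hZ : Z = 1) (A : Obj n) : Mor (Z * A) A := (basisLeftUnitor hZ A).toMor

/-- The right unitor `A ⬝ Z → A`, for the unit object `Z`. -/
def rightUnitor {Z : Obj n} (hZ : Z = 1) (A : Obj n) : Mor (A * Z) A :=
  (basisRightUnitor hZ A).toMor

theorem eq_unitIndex {Z : Obj n} (hZ : Z = 1) {i : Fin n} (z : Fin (Z i i)) :
    z = unitIndex hZ i := (exists_eq_unitIndex hZ z).2

theorem leftUnitor_naturality {Z A B : Obj n} (hZ : Z = 1) (f : Mor A B) :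
    ((Mor.id Z).mul f).comp (leftUnitor hZ B) = (leftUnitor hZ A).comp f := by
  refine Mor.ext_apply fun i k v p => ?_
  rw [Mor.comp_apply, Mor.comp_apply, leftUnitor, BasisMor.toMor_apply, basisLeftUnitor_symm,
    Mor.mul_apply, VHom.apply_eq_sum, Fintype.sum_prod_type,
    Finset.sum_eq_single (unitIndex hZ i) (fun z _ h => absurd (eq_unitIndex hZ z) h)
      (fun h => absurd (Finset.mem_univ _) h)]
  refine Finset.sum_congr rfl fun q _ => ?_
  simp [leftUnitor, BasisMor.toMor_apply, basisLeftUnitor_symm, Mor.id]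

theorem rightUnitor_naturality {Z A B : Obj n} (hZ : Z = 1) (f : Mor A B) :
    (f.mul (Mor.id Z)).comp (rightUnitor hZ B) = (rightUnitor hZ A).comp f := by
  refine Mor.ext_apply fun i k v p => ?_
  rw [Mor.comp_apply, Mor.comp_apply, rightUnitor, BasisMor.toMor_apply, basisRightUnitor_symm,
    Mor.mul_apply, VHom.apply_eq_sum, Fintype.sum_prod_type]
  refine Finset.sum_congr rfl fun q _ => ?_
  rw [Finset.sum_eq_single (unitIndex hZ k) (fun z _ h => absurd (eq_unitIndex hZ z) h)
      (fun h => absurd (Finset.mem_univ _) h)]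
  simp [rightUnitor, BasisMor.toMor_apply, basisRightUnitor_symm, Mor.id]

theorem triangle_left {Z : Obj n} (hZ : Z = 1) (B C : Obj n) :
    (assoc Z B C).comp ((leftUnitor hZ B).mul (Mor.id C)) = leftUnitor hZ (B * C) := by
  rw [← basisAssoc_toMor, ← BasisMor.toMor_id, leftUnitor, leftUnitor, ← BasisMor.toMor_mul,
    ← BasisMor.toMor_comp, basis_triangle_left]

theorem triangle_middle {Z : Obj n} (hZ : Z = 1) (A C : Obj n) :
    (assoc A Z C).comp ((rightUnitor hZ A).mul (Mor.id C)) =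
      (Mor.id A).mul (leftUnitor hZ C) := by
  rw [← basisAssoc_toMor, ← BasisMor.toMor_id, ← BasisMor.toMor_id, leftUnitor, rightUnitor,
    ← BasisMor.toMor_mul, ← BasisMor.toMor_mul, ← BasisMor.toMor_comp, basis_triangle_middle]

theorem triangle_right {Z : Obj n} (hZ : Z = 1) (A B : Obj n) :
    (assoc A B Z).comp (rightUnitor hZ (A * B)) = (Mor.id A).mul (rightUnitor hZ B) := by
  rw [← basisAssoc_toMor, ← BasisMor.toMor_id, rightUnitor, rightUnitor,
    ← BasisMor.toMor_mul, ← BasisMor.toMor_comp, basis_triangle_right]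

theorem Mor.comp_assoc {A B C D : Obj n} (f : Mor A B) (g : Mor B C) (h : Mor C D) :
    (f.comp g).comp h = f.comp (g.comp h) := rfl

/-! ### Čech cochains with values in the signs -/

theorem units_zpow_neg_one_pow (s : ℤˣ) (k : ℕ) : s ^ ((-1 : ℤ) ^ k) = s :=
  units_zpow_of_isUnit s (isUnit_one.neg.pow k)

section Cech

variable {X : Type u} [TopologicalSpace X]

namespace OpenCover

theorem δ_apply (𝒰 : OpenCover X) {p : ℕ} (f : 𝒰.Cochain p) (s : Fin (p + 2) → 𝒰.ι)
    (x : 𝒰.inter s) :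
    𝒰.δ f s x = ∏ i : Fin (p + 2), f (s ∘ i.succAbove) ⟨x.1, fun j => x.2 (i.succAbove j)⟩ := by
  refine (map_prod (LocallyConstant.evalMonoidHom (Y := ℤˣ) x) _ _).trans ?_
  exact Finset.prod_congr rfl fun i _ => units_zpow_neg_one_pow _ _

theorem cochain_ext {𝒰 : OpenCover X} {p : ℕ} {f g : 𝒰.Cochain p}
    (h : ∀ (s : Fin (p + 1) → 𝒰.ι) (x : X) (hx : x ∈ 𝒰.inter s), f s ⟨x, hx⟩ = g s ⟨x, hx⟩) :
    f = g :=
  funext fun s => LocallyConstant.ext fun x => h s x.1 x.2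

theorem δ_mul (𝒰 : OpenCover X) {p : ℕ} (f g : 𝒰.Cochain p) : 𝒰.δ (f * g) = 𝒰.δ f * 𝒰.δ g := by
  refine cochain_ext fun s x hx => ?_
  simp only [δ_apply, Pi.mul_apply, LocallyConstant.mul_apply, Finset.prod_mul_distrib]

theorem inv_eq_self {𝒰 : OpenCover X} {p : ℕ} (f : 𝒰.Cochain p) : f⁻¹ = f :=
  cochain_ext fun _ _ _ => Int.units_inv_eq_self _

theorem mul_self {𝒰 : OpenCover X} {p : ℕ} (f : 𝒰.Cochain p) : f * f = 1 :=
  cochain_ext fun _ _ _ => Int.units_mul_self _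

/-- Composition of refinement maps. -/
def Refinement.comp {𝒰 𝒱 𝒲 : OpenCover X} (r : 𝒰.Refinement 𝒱) (s : 𝒱.Refinement 𝒲) :
    𝒰.Refinement 𝒲 where
  map := r.map ∘ s.map
  le j := (s.le j).trans (r.le _)

theorem Refinement.pullback_comp {𝒰 𝒱 𝒲 : OpenCover X} (r : 𝒰.Refinement 𝒱)
    (s : 𝒱.Refinement 𝒲) {p : ℕ} (f : 𝒰.Cochain p) :
    (r.comp s).pullback f = s.pullback (r.pullback f) := rfl

theorem Refinement.pullback_mul {𝒰 𝒱 : OpenCover X} (r : 𝒰.Refinement 𝒱) {p : ℕ}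
    (f g : 𝒰.Cochain p) : r.pullback (f * g) = r.pullback f * r.pullback g := rfl

theorem Refinement.pullback_apply {𝒰 𝒱 : OpenCover X} (r : 𝒰.Refinement 𝒱) {p : ℕ}
    (f : 𝒰.Cochain p) (s : Fin (p + 1) → 𝒱.ι) (x : X) (hx : x ∈ 𝒱.inter s) :
    r.pullback f s ⟨x, hx⟩ = f (r.map ∘ s) ⟨x, fun j => r.le (s j) (hx j)⟩ := rfl

theorem Refinement.pullback_δ {𝒰 𝒱 : OpenCover X} (r : 𝒰.Refinement 𝒱) {p : ℕ}
    (f : 𝒰.Cochain p) : r.pullback (𝒰.δ f) = 𝒱.δ (r.pullback f) := by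
  refine cochain_ext fun s x hx => ?_
  rw [pullback_apply, δ_apply, δ_apply]
  rfl

theorem Refinement.isCoboundary_pullback {𝒰 𝒱 : OpenCover X} (r : 𝒰.Refinement 𝒱)
    {p : ℕ} {f : 𝒰.Cochain (p + 1)} (hf : 𝒰.IsCoboundary f) : 𝒱.IsCoboundary (r.pullback f) := by
  obtain ⟨h, rfl⟩ := hf
  exact ⟨r.pullback h, (r.pullback_δ h).symm⟩

theorem IsCoboundary.mul {𝒰 : OpenCover X} {p : ℕ} {f g : 𝒰.Cochain (p + 1)}
    (hf : 𝒰.IsCoboundary f) (hg : 𝒰.IsCoboundary g) : 𝒰.IsCoboundary (f * g) := by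
  obtain ⟨h, rfl⟩ := hf
  obtain ⟨k, rfl⟩ := hg
  exact ⟨h * k, 𝒰.δ_mul h k⟩

/-- The cover by the intersections of members of two covers. -/
def meet (𝒰 𝒱 : OpenCover X) : OpenCover X where
  ι := 𝒰.ι × 𝒱.ι
  U i := 𝒰.U i.1 ⊓ 𝒱.U i.2
  exists_mem x := by
    obtain ⟨i, hi⟩ := 𝒰.exists_mem x
    obtain ⟨j, hj⟩ := 𝒱.exists_mem x
    exact ⟨(i, j), hi, hj⟩

/-- The projection of the common refinement to the first cover. -/
def meetLeft (𝒰 𝒱 : OpenCover X) : 𝒰.Refinement (𝒰.meet 𝒱) := ⟨Prod.fst, fun _ => inf_le_left⟩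

/-- The projection of the common refinement to the second cover. -/
def meetRight (𝒰 𝒱 : OpenCover X) : 𝒱.Refinement (𝒰.meet 𝒱) := ⟨Prod.snd, fun _ => inf_le_right⟩

end OpenCover

/-! ### The prism operator -/

/-- The prism operator on functions of 4-tuples: the sum over the top simplices of the triangulated
prism with ends `a` and `b`, without the signs, as the values are `±1`. -/
def prism {ι : Type*} (F : (Fin 4 → ι) → ℤˣ) (a b : Fin 3 → ι) : ℤˣ :=
  F ![a 0, b 0, b 1, b 2] * F ![a 0, a 1, b 1, b 2] * F ![a 0, a 1, a 2, b 2]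

/-- The differential of the prism operator on a cocycle is the difference of the two ends. The
function need be a cocycle only on a set `S` of indices, such as those of the members of a cover
that contain a given point. -/
theorem prod_prism {ι : Type*} (F : (Fin 4 → ι) → ℤˣ) (S : Set ι)
    (hF : ∀ s : Fin 5 → ι, (∀ i, s i ∈ S) → ∏ i : Fin 5, F (s ∘ i.succAbove) = 1)
    (a b : Fin 4 → ι) (ha : ∀ i, a i ∈ S) (hb : ∀ i, b i ∈ S) :
    ∏ i : Fin 4, prism F (a ∘ i.succAbove) (b ∘ i.succAbove) = F a * F b := by
  have key : ∀ a₀ a₁ a₂ a₃ a₄, a₀ ∈ S → a₁ ∈ S → a₂ ∈ S → a₃ ∈ S → a₄ ∈ S →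
      F ![a₁, a₂, a₃, a₄] * F ![a₀, a₂, a₃, a₄] * F ![a₀, a₁, a₃, a₄] * F ![a₀, a₁, a₂, a₄] *
        F ![a₀, a₁, a₂, a₃] = 1 := by
    intro a₀ a₁ a₂ a₃ a₄ h₀ h₁ h₂ h₃ h₄
    have := hF ![a₀, a₁, a₂, a₃, a₄] (by intro i; fin_cases i <;> assumption)
    rw [Fin.prod_univ_five] at this
    rw [← this]
    congr <;> (funext i; fin_cases i <;> rfl)
  have e₁ := key (a 0) (b 0) (b 1) (b 2) (b 3) (ha 0) (hb 0) (hb 1) (hb 2) (hb 3)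
  have e₂ := key (a 0) (a 1) (b 1) (b 2) (b 3) (ha 0) (ha 1) (hb 1) (hb 2) (hb 3)
  have e₃ := key (a 0) (a 1) (a 2) (b 2) (b 3) (ha 0) (ha 1) (ha 2) (hb 2) (hb 3)
  have e₄ := key (a 0) (a 1) (a 2) (a 3) (b 3) (ha 0) (ha 1) (ha 2) (ha 3) (hb 3)
  have hFa : F a = F ![a 0, a 1, a 2, a 3] := congrArg F (List.ofFn_inj.mp rfl)
  have hFb : F b = F ![b 0, b 1, b 2, b 3] := congrArg F (List.ofFn_inj.mp rfl)
  have hL : ∏ i : Fin 4, prism F (a ∘ i.succAbove) (b ∘ i.succAbove) =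
      (F ![a 1, b 1, b 2, b 3] * F ![a 1, a 2, b 2, b 3] * F ![a 1, a 2, a 3, b 3]) *
      (F ![a 0, b 0, b 2, b 3] * F ![a 0, a 2, b 2, b 3] * F ![a 0, a 2, a 3, b 3]) *
      (F ![a 0, b 0, b 1, b 3] * F ![a 0, a 1, b 1, b 3] * F ![a 0, a 1, a 3, b 3]) *
      (F ![a 0, b 0, b 1, b 2] * F ![a 0, a 1, b 1, b 2] * F ![a 0, a 1, a 2, b 2]) := by
    rw [Fin.prod_univ_four]
    rfl
  rw [hFa, hFb, hL]
  generalize F ![a 0, a 1, a 2, a 3] = u₀ at *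
  generalize F ![b 0, b 1, b 2, b 3] = u₁ at *
  -- the terms that two of the four cocycle identities share
  have d₁ := Int.units_mul_self (F ![a 0, b 1, b 2, b 3])
  have d₂ := Int.units_mul_self (F ![a 0, a 1, b 2, b 3])
  have d₃ := Int.units_mul_self (F ![a 0, a 1, a 2, b 3])
  have d₄ := Int.units_mul_self u₀
  have d₅ := Int.units_mul_self u₁
  refine mul_right_cancel (b := (u₀ * u₁)) ?_
  calc _ = _ * 1 * 1 * 1 := by rw [mul_one, mul_one, mul_one]
    _ = _ * (F ![a 0, b 1, b 2, b 3] * F ![a 0, b 1, b 2, b 3]) *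
        (F ![a 0, a 1, b 2, b 3] * F ![a 0, a 1, b 2, b 3]) *
        (F ![a 0, a 1, a 2, b 3] * F ![a 0, a 1, a 2, b 3]) := by rw [d₁, d₂, d₃]
    _ = 1 * 1 * 1 * 1 := by
      refine Eq.trans (Units.ext ?_) (congrArg₂ (· * ·) (congrArg₂ (· * ·)
        (congrArg₂ (· * ·) e₁ e₂) e₃) e₄)
      push_cast
      ring
    _ = (u₀ * u₀) * (u₁ * u₁) := by rw [d₄, d₅]; rfl
    _ = _ := mul_mul_mul_comm _ _ _ _

namespace OpenCover

open Classical in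
/-- The values at a point `x` of a cochain, extended by `1` to all tuples. -/
def Cochain.at {𝒰 : OpenCover X} {p : ℕ} (f : 𝒰.Cochain p) (x : X) (s : Fin (p + 1) → 𝒰.ι) : ℤˣ :=
  if hx : x ∈ 𝒰.inter s then f s ⟨x, hx⟩ else 1

theorem Cochain.at_of_mem {𝒰 : OpenCover X} {p : ℕ} (f : 𝒰.Cochain p) {x : X}
    {s : Fin (p + 1) → 𝒰.ι} (hx : x ∈ 𝒰.inter s) : f s ⟨x, hx⟩ = f.at x s :=
  by rw [Cochain.at, dif_pos hx]

theorem mem_inter_four {𝒰 : OpenCover X} {x : X} {a b c d : 𝒰.ι} (ha : x ∈ 𝒰.U a)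
    (hb : x ∈ 𝒰.U b) (hc : x ∈ 𝒰.U c) (hd : x ∈ 𝒰.U d) : x ∈ 𝒰.inter ![a, b, c, d] := by
  intro i
  fin_cases i <;> assumption

theorem IsCocycle.prod_at {𝒰 : OpenCover X} {p : ℕ} {f : 𝒰.Cochain p} (hf : 𝒰.IsCocycle f) (x : X)
    (s : Fin (p + 2) → 𝒰.ι) (hs : x ∈ 𝒰.inter s) :
    ∏ i : Fin (p + 2), f.at x (s ∘ i.succAbove) = 1 := by
  have h := DFunLike.congr_fun (congrFun hf s) ⟨x, hs⟩
  rw [δ_apply] at h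
  refine Eq.trans (Finset.prod_congr rfl fun i _ => ?_) h
  exact (Cochain.at_of_mem f (s := s ∘ i.succAbove) fun j => hs (i.succAbove j)).symm

/-- Two refinement maps induce cohomologous pullbacks of a cocycle. -/
theorem IsCocycle.isCoboundary_pullback_mul {𝒰 𝒱 : OpenCover X} {f : 𝒰.Cochain 3}
    (hf : 𝒰.IsCocycle f) (r r' : 𝒰.Refinement 𝒱) :
    𝒱.IsCoboundary (r.pullback f * r'.pullback f) := by
  have hr : ∀ {k : ℕ} (s : Fin k → 𝒱.ι) (x : X), x ∈ 𝒱.inter s → ∀ i, x ∈ 𝒰.U (r.map (s i)) :=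
    fun s x hx i => r.le _ (hx i)
  have hr' : ∀ {k : ℕ} (s : Fin k → 𝒱.ι) (x : X), x ∈ 𝒱.inter s → ∀ i, x ∈ 𝒰.U (r'.map (s i)) :=
    fun s x hx i => r'.le _ (hx i)
  let pull : ∀ {k p : ℕ} (g : 𝒰.Cochain p) (t : Fin (p + 1) → 𝒰.ι) (s : Fin k → 𝒱.ι),
      𝒱.inter s ⊆ 𝒰.inter t → LocallyConstant (𝒱.inter s) ℤˣ := fun g t s h =>
    (g t).comap ⟨Set.inclusion h, continuous_inclusion h⟩
  let h : 𝒱.Cochain 2 := fun s =>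
    pull f ![r.map (s 0), r'.map (s 0), r'.map (s 1), r'.map (s 2)] s
      (fun x hx => mem_inter_four (hr s x hx 0) (hr' s x hx 0) (hr' s x hx 1) (hr' s x hx 2)) *
    pull f ![r.map (s 0), r.map (s 1), r'.map (s 1), r'.map (s 2)] s
      (fun x hx => mem_inter_four (hr s x hx 0) (hr s x hx 1) (hr' s x hx 1) (hr' s x hx 2)) *
    pull f ![r.map (s 0), r.map (s 1), r.map (s 2), r'.map (s 2)] s
      (fun x hx => mem_inter_four (hr s x hx 0) (hr s x hx 1) (hr s x hx 2) (hr' s x hx 2))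
  have hh : ∀ (s : Fin 3 → 𝒱.ι) (x : X) (hx : x ∈ 𝒱.inter s),
      h s ⟨x, hx⟩ = prism (f.at x) (r.map ∘ s) (r'.map ∘ s) := fun s x hx =>
    congrArg₂ (· * ·) (congrArg₂ (· * ·) (f.at_of_mem _) (f.at_of_mem _)) (f.at_of_mem _)
  refine ⟨h, cochain_ext fun s x hx => ?_⟩
  rw [δ_apply]
  refine (Finset.prod_congr rfl fun i _ => hh _ _ _).trans ?_
  refine (prod_prism (f.at x) {α | x ∈ 𝒰.U α} (fun t ht => hf.prod_at x t ht) (r.map ∘ s)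
    (r'.map ∘ s) (hr s x hx) (hr' s x hx)).trans ?_
  exact (congrArg₂ (· * ·) (f.at_of_mem (s := r.map ∘ s) (hr s x hx))
    (f.at_of_mem (s := r'.map ∘ s) (hr' s x hx))).symm

/-- A cocycle becomes a coboundary on some refinement of its cover. -/
def EventuallyTrivial (a : Σ 𝒰 : OpenCover X, {f : 𝒰.Cochain 3 // 𝒰.IsCocycle f}) : Prop :=
  ∃ (𝒱 : OpenCover X) (r : a.1.Refinement 𝒱), 𝒱.IsCoboundary (r.pullback a.2.1)

theorem eventuallyTrivial_iff_of_cechRel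
    {a b : Σ 𝒰 : OpenCover X, {f : 𝒰.Cochain 3 // 𝒰.IsCocycle f}} (h : CechRel X 3 a b) :
    EventuallyTrivial a ↔ EventuallyTrivial b := by
  obtain ⟨r, hr⟩ := h
  rw [inv_eq_self] at hr
  constructor
  · rintro ⟨𝒱, s, hs⟩
    refine ⟨𝒱.meet b.1, 𝒱.meetRight b.1, ?_⟩
    -- the two refinement maps from the common refinement to the cover of `a` are homotopic
    have h₁ := a.2.2.isCoboundary_pullback_mul (s.comp (𝒱.meetLeft b.1))
      (r.comp (𝒱.meetRight b.1))
    have h₂ := (h₁.mul ((𝒱.meetLeft b.1).isCoboundary_pullback hs)).mul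
      ((𝒱.meetRight b.1).isCoboundary_pullback hr)
    convert h₂ using 1
    rw [Refinement.pullback_comp, Refinement.pullback_comp, Refinement.pullback_mul]
    generalize (𝒱.meetLeft b.1).pullback (s.pullback a.2.1) = x
    generalize (𝒱.meetRight b.1).pullback (r.pullback a.2.1) = y
    generalize (𝒱.meetRight b.1).pullback b.2.1 = z
    calc z = (x * x) * (y * y) * z := by rw [mul_self, mul_self, one_mul, one_mul]
      _ = _ := by ac_rfl
  · rintro ⟨𝒱, s, hs⟩
    refine ⟨𝒱, r.comp s, ?_⟩
    have h₂ := (s.isCoboundary_pullback hr).mul hs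
    convert h₂ using 1
    rw [Refinement.pullback_comp, Refinement.pullback_mul, mul_assoc, mul_self, mul_one]

theorem isCoboundary_one (𝒰 : OpenCover X) {p : ℕ} : 𝒰.IsCoboundary (1 : 𝒰.Cochain (p + 1)) :=
  ⟨1, 𝒰.isCocycle_one⟩

/-- A cocycle with trivial class becomes a coboundary on some refinement of its cover. -/
theorem exists_isCoboundary_of_cechClass_eq_one (𝒰 : OpenCover X) (f : 𝒰.Cochain 3)
    (hf : 𝒰.IsCocycle f) (h : cechClass 𝒰 f hf = 1) :
    ∃ (𝒱 : OpenCover X) (r : 𝒰.Refinement 𝒱), 𝒱.IsCoboundary (r.pullback f) := by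
  have key : ∀ a b, Relation.EqvGen (CechRel X 3) a b →
      (EventuallyTrivial a ↔ EventuallyTrivial b) := by
    intro a b hab
    induction hab with
    | rel a b h => exact eventuallyTrivial_iff_of_cechRel h
    | refl a => exact Iff.rfl
    | symm a b _ ih => exact ih.symm
    | trans a b c _ _ ih₁ ih₂ => exact ih₁.trans ih₂
  exact (key _ _ (Quot.eqvGen_exact h)).mpr
    ⟨_, ⟨id, fun _ => le_rfl⟩, isCoboundary_one _⟩

/-- A coboundary has trivial class. -/
theorem cechClass_eq_one (𝒰 : OpenCover X) (f : 𝒰.Cochain 3) (hf : 𝒰.IsCocycle f)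
    (h : 𝒰.IsCoboundary f) : cechClass 𝒰 f hf = 1 := by
  refine (Quot.sound ⟨⟨fun _ => ⟨⟩, fun _ _ _ => trivial⟩, ?_⟩).symm
  have : 𝒰.IsCoboundary (1 * f⁻¹) := by rwa [one_mul, inv_eq_self]
  exact this

end OpenCover

end Cech

/-! ### Tuples of indices and their orderings -/

section Tuples

variable {ι : Type*} [PartialOrder ι]

/-- A tuple can be sorted in at most one way. -/
theorem perm_unique_of_strictMono {m : ℕ} {s : Fin m → ι} {σ τ : Equiv.Perm (Fin m)}
    (hσ : StrictMono (s ∘ σ)) (hτ : StrictMono (s ∘ τ)) : σ = τ := by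
  have h : StrictMono (σ⁻¹ * τ : Equiv.Perm (Fin m)) := by
    intro i j hij
    rw [← hσ.lt_iff_lt]
    simpa using hτ hij
  have h2 : h.orderIsoOfSurjective _ (σ⁻¹ * τ).surjective = OrderIso.refl _ :=
    Subsingleton.elim _ _
  have h3 : σ⁻¹ * τ = 1 := Equiv.ext fun i => DFunLike.congr_fun h2 i
  exact inv_mul_eq_one.mp h3

/-- An injective tuple of pairwise comparable elements can be sorted. -/
theorem exists_perm_strictMono {m : ℕ} {s : Fin m → ι} (hs : Function.Injective s)
    (htot : ∀ i j, s i ≤ s j ∨ s j ≤ s i) : ∃ σ : Equiv.Perm (Fin m), StrictMono (s ∘ σ) := by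
  let s' : Fin m → LinearExtension ι := fun i => toLinearExtension (s i)
  have hs' : Monotone (s' ∘ Tuple.sort s') := Tuple.monotone_sort s'
  refine ⟨Tuple.sort s', fun i j hij => ?_⟩
  have hne : s (Tuple.sort s' i) ≠ s (Tuple.sort s' j) := fun h =>
    hij.ne ((Tuple.sort s').injective (hs h))
  rcases htot (Tuple.sort s' i) (Tuple.sort s' j) with h | h
  · exact lt_of_le_of_ne h hne
  · have h1 : s' (Tuple.sort s' j) ≤ s' (Tuple.sort s' i) := toLinearExtension.monotone h
    exact absurd (le_antisymm (hs' hij.le) h1) hne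

/-- Omitting an entry of a permuted tuple gives a permutation of the tuple without this entry. -/
theorem exists_perm_comp_succAbove {m : ℕ} (σ : Equiv.Perm (Fin (m + 1))) (i : Fin (m + 1)) :
    ∃ τ : Equiv.Perm (Fin m), σ ∘ i.succAbove = (σ i).succAbove ∘ τ := by
  refine ⟨(finSuccAboveEquiv i).trans ((σ.subtypeEquiv fun a => by simp).trans
    (finSuccAboveEquiv (σ i)).symm), funext fun j => ?_⟩
  have h := ((finSuccAboveEquiv (σ i)).apply_symm_apply
    (σ.subtypeEquiv (p := (· ≠ i)) (q := (· ≠ σ i)) (fun a => by simp)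
      (finSuccAboveEquiv i j)))
  exact (congrArg Subtype.val h).symm

end Tuples

/-- To compute the alternating sum of an alternating function over the faces of a tuple, it
suffices to do so for sorted tuples. -/
theorem prod_succAbove_eq {ι : Type*} [PartialOrder ι] {m : ℕ} (F : (Fin m → ι) → ℤˣ)
    (G : (Fin (m + 1) → ι) → ℤˣ)
    (hF : ∀ s (τ : Equiv.Perm (Fin m)), F (s ∘ τ) = F s)
    (hF' : ∀ s, ¬ Function.Injective s → F s = 1)
    (hG : ∀ s (τ : Equiv.Perm (Fin (m + 1))), G (s ∘ τ) = G s)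
    (hG' : ∀ s, ¬ Function.Injective s → G s = 1) (s : Fin (m + 1) → ι)
    (htot : ∀ i j, s i ≤ s j ∨ s j ≤ s i)
    (hchain : ∀ σ : Equiv.Perm (Fin (m + 1)), StrictMono (s ∘ σ) →
      ∏ i : Fin (m + 1), F ((s ∘ σ) ∘ i.succAbove) = G (s ∘ σ)) :
    ∏ i : Fin (m + 1), F (s ∘ i.succAbove) = G s := by
  have hface : ∀ (σ : Equiv.Perm (Fin (m + 1))) i,
      F ((s ∘ σ) ∘ i.succAbove) = F (s ∘ (σ i).succAbove) := by
    intro σ i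
    obtain ⟨τ, hτ⟩ := exists_perm_comp_succAbove σ i
    rw [Function.comp_assoc, hτ, ← Function.comp_assoc, hF]
  by_cases hs : Function.Injective s
  · obtain ⟨σ, hσ⟩ := exists_perm_strictMono hs htot
    rw [← hG s σ, ← hchain σ hσ, ← Equiv.prod_comp σ]
    exact Finset.prod_congr rfl fun i _ => (hface σ i).symm
  · obtain ⟨p, q, hpq, hne⟩ : ∃ p q, s p = s q ∧ p ≠ q := by
      simpa [Function.Injective] using hs
    have hsw : s ∘ Equiv.swap p q = s := by
      rw [Equiv.comp_swap_eq_update, hpq, Function.update_eq_self, ← hpq, Function.update_eq_self]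
    -- only the faces without one of two equal entries contribute, and they agree
    have h1 : F (s ∘ p.succAbove) = F (s ∘ q.succAbove) := by
      have := hface (Equiv.swap p q) p
      rwa [hsw, Equiv.swap_apply_left] at this
    rw [hG' s hs, ← Finset.prod_subset (Finset.subset_univ {p, q}), Finset.prod_pair hne, h1,
      Int.units_mul_self]
    intro i _ hi
    have hip : p ≠ i := fun h => hi (by simp [h])
    have hiq : q ≠ i := fun h => hi (by simp [h])
    refine hF' _ fun hinj' => hne ?_
    obtain ⟨p', rfl⟩ := Fin.exists_succAbove_eq hip
    obtain ⟨q', rfl⟩ := Fin.exists_succAbove_eq hiq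
    exact congrArg _ (hinj' hpq)

/-! ### The signs of a 2-vector bundle -/

section Bundles

variable {E : Type*} [NormedAddCommGroup E] [NormedSpace ℝ E] {H : Type*} [TopologicalSpace H]
variable {I : ModelWithCorners ℝ E H} {X : Type u} [TopologicalSpace X] [ChartedSpace H X]

namespace TwoVectorBundle

/-- The sign of the associator for a chain of four indices. -/
def chainSgn (𝓔 : TwoVectorBundle I X n) (s : Fin 4 → 𝓔.cover.ι) (hs : StrictMono s) : ℤˣ :=
  𝓔.sgn (hs (show (0 : Fin 4) < 1 by decide)) (hs (show (1 : Fin 4) < 2 by decide))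
    (hs (show (2 : Fin 4) < 3 by decide))

open Classical in
/-- The value of `sgnCochain` on a 4-tuple, which is constant in the points of `X`. -/
def sgnValue (𝓔 : TwoVectorBundle I X n) (s : Fin 4 → 𝓔.cover.ι) : ℤˣ :=
  if h : ∃ σ : Equiv.Perm (Fin 4), StrictMono (s ∘ σ) then 𝓔.chainSgn _ h.choose_spec else 1

theorem sgnCochain_apply (𝓔 : TwoVectorBundle I X n) (s : Fin 4 → 𝓔.cover.ι) (x) :
    𝓔.sgnCochain s x = 𝓔.sgnValue s := by
  unfold sgnCochain sgnValue
  split_ifs <;> rfl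

theorem chainSgn_congr (𝓔 : TwoVectorBundle I X n) {s t : Fin 4 → 𝓔.cover.ι} (h : s = t)
    (hs : StrictMono s) (ht : StrictMono t) : 𝓔.chainSgn s hs = 𝓔.chainSgn t ht := by
  subst h; rfl

theorem sgnValue_of_strictMono_comp (𝓔 : TwoVectorBundle I X n) {s : Fin 4 → 𝓔.cover.ι}
    {σ : Equiv.Perm (Fin 4)} (hσ : StrictMono (s ∘ σ)) : 𝓔.sgnValue s = 𝓔.chainSgn _ hσ := by
  have h : ∃ σ : Equiv.Perm (Fin 4), StrictMono (s ∘ σ) := ⟨σ, hσ⟩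
  rw [sgnValue, dif_pos h]
  exact 𝓔.chainSgn_congr (by rw [perm_unique_of_strictMono h.choose_spec hσ]) _ _

theorem sgnValue_of_strictMono (𝓔 : TwoVectorBundle I X n) {s : Fin 4 → 𝓔.cover.ι}
    (hs : StrictMono s) : 𝓔.sgnValue s = 𝓔.chainSgn s hs :=
  𝓔.sgnValue_of_strictMono_comp (σ := 1) hs

theorem sgnValue_of_not_exists (𝓔 : TwoVectorBundle I X n) {s : Fin 4 → 𝓔.cover.ι}
    (hs : ¬ ∃ σ : Equiv.Perm (Fin 4), StrictMono (s ∘ σ)) : 𝓔.sgnValue s = 1 := dif_neg hs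

theorem sgnValue_of_not_injective (𝓔 : TwoVectorBundle I X n) (s : Fin 4 → 𝓔.cover.ι)
    (hs : ¬ Function.Injective s) : 𝓔.sgnValue s = 1 :=
  𝓔.sgnValue_of_not_exists fun ⟨σ, hσ⟩ => hs ((Equiv.injective_comp σ s).mp hσ.injective)

theorem sgnValue_comp_perm (𝓔 : TwoVectorBundle I X n) (s : Fin 4 → 𝓔.cover.ι)
    (τ : Equiv.Perm (Fin 4)) : 𝓔.sgnValue (s ∘ τ) = 𝓔.sgnValue s := by
  by_cases h : ∃ σ : Equiv.Perm (Fin 4), StrictMono (s ∘ σ)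
  · obtain ⟨σ, hσ⟩ := h
    have he : (s ∘ τ) ∘ (τ⁻¹ * σ : Equiv.Perm (Fin 4)) = s ∘ σ := by
      funext i; simp
    rw [𝓔.sgnValue_of_strictMono_comp hσ,
      𝓔.sgnValue_of_strictMono_comp (s := s ∘ τ) (σ := τ⁻¹ * σ) (by rwa [he])]
    exact 𝓔.chainSgn_congr he _ _
  · rw [𝓔.sgnValue_of_not_exists h, 𝓔.sgnValue_of_not_exists]
    rintro ⟨σ, hσ⟩
    exact h ⟨τ * σ, hσ⟩

/-- The cocycle identity for the signs on indices with a common point. -/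
theorem prod_sgnValue (𝓔 : TwoVectorBundle I X n) (x : X) (s : Fin 5 → 𝓔.cover.ι)
    (hx : ∀ i, x ∈ 𝓔.cover.U (s i)) : ∏ i : Fin 5, 𝓔.sgnValue (s ∘ i.succAbove) = 1 := by
  refine prod_succAbove_eq 𝓔.sgnValue 1 𝓔.sgnValue_comp_perm 𝓔.sgnValue_of_not_injective
    (fun _ _ => rfl) (fun _ _ => rfl) s
    (fun i j => 𝓔.cover.total _ _ x (hx i) (hx j)) fun σ hσ => ?_
  rw [Pi.one_apply]
  have hx' : ∀ i, x ∈ 𝓔.cover.U ((s ∘ σ) i) := fun i => hx (σ i)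
  generalize s ∘ σ = t at hσ hx'
  have hface : ∀ i : Fin 5, StrictMono (t ∘ i.succAbove) := fun i =>
    hσ.comp (Fin.strictMono_succAbove i)
  have h01 : t 0 < t 1 := hσ (by decide)
  have h12 : t 1 < t 2 := hσ (by decide)
  have h23 : t 2 < t 3 := hσ (by decide)
  have h34 : t 3 < t 4 := hσ (by decide)
  have e02 := 𝓔.obj_mul h01 h12 ⟨x, ⟨hx' 0, hx' 1⟩, hx' 2⟩
  have e13 := 𝓔.obj_mul h12 h23 ⟨x, ⟨hx' 1, hx' 2⟩, hx' 3⟩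
  have e24 := 𝓔.obj_mul h23 h34 ⟨x, ⟨hx' 2, hx' 3⟩, hx' 4⟩
  have hp := assocSgn_pentagon (𝓔.obj h01) (𝓔.obj h12) (𝓔.obj h23) (𝓔.obj h34)
    (𝓔.weaklyInvertible h01) (𝓔.weaklyInvertible h34)
  rw [e02, e13, e24] at hp
  rw [Fin.prod_univ_five, 𝓔.sgnValue_of_strictMono (hface 0), 𝓔.sgnValue_of_strictMono (hface 1),
    𝓔.sgnValue_of_strictMono (hface 2), 𝓔.sgnValue_of_strictMono (hface 3),
    𝓔.sgnValue_of_strictMono (hface 4)]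
  have f0 : 𝓔.chainSgn _ (hface 0) = assocSgn (𝓔.obj h12) (𝓔.obj h23) (𝓔.obj h34) := rfl
  have f1 : 𝓔.chainSgn _ (hface 1) =
    assocSgn (𝓔.obj (h01.trans h12)) (𝓔.obj h23) (𝓔.obj h34) := rfl
  have f2 : 𝓔.chainSgn _ (hface 2) =
    assocSgn (𝓔.obj h01) (𝓔.obj (h12.trans h23)) (𝓔.obj h34) := rfl
  have f3 : 𝓔.chainSgn _ (hface 3) =
    assocSgn (𝓔.obj h01) (𝓔.obj h12) (𝓔.obj (h23.trans h34)) := rfl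
  have f4 : 𝓔.chainSgn _ (hface 4) = assocSgn (𝓔.obj h01) (𝓔.obj h12) (𝓔.obj h23) := rfl
  rw [f0, f1, f2, f3, f4]
  generalize assocSgn _ _ _ = a at *
  generalize assocSgn _ _ _ = b at *
  generalize assocSgn _ _ _ = c at *
  generalize assocSgn _ _ _ = d at *
  generalize assocSgn _ _ _ = e at *
  clear * - hp
  revert a b c d e
  decide

/-- The signs of the associators form a cocycle: the pentagon for the associators. -/
theorem isCocycle_sgnCochain (𝓔 : TwoVectorBundle I X n) :
    𝓔.cover.toOpenCover.IsCocycle 𝓔.sgnCochain := by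
  refine OpenCover.cochain_ext fun s x hx => ?_
  rw [OpenCover.δ_apply]
  exact (Finset.prod_congr rfl fun i _ => 𝓔.sgnCochain_apply _ _).trans (𝓔.prod_sgnValue x s hx)

end TwoVectorBundle

end Bundles

/-! ### Piecewise constant functions on the unit interval -/

/-- `a` and `b` are the right and the left limits, at every point of the unit interval, of a
piecewise constant function. -/
def IsStepPair {α : Type*} (a b : Set.Icc (0 : ℝ) 1 → α) : Prop :=
  ∀ t, (∀ᶠ t' in 𝓝[>] t, a t' = a t ∧ b t' = a t) ∧ (∀ᶠ t' in 𝓝[<] t, a t' = b t ∧ b t' = b t)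

theorem IsStepPair.finite_jumps {α : Type*} {a b : Set.Icc (0 : ℝ) 1 → α} (h : IsStepPair a b) :
    {t | a t ≠ b t}.Finite := by
  by_contra hinf
  obtain ⟨t, ht⟩ := Set.Infinite.exists_accPt_principal (s := {t | a t ≠ b t}) hinf
  rw [accPt_iff_frequently_nhdsNE] at ht
  refine ht ?_
  rw [← nhdsLT_sup_nhdsGT, Filter.eventually_sup]
  exact ⟨(h t).2.mono fun t' ht' hne => hne (ht'.1.trans ht'.2.symm),
    (h t).1.mono fun t' ht' hne => hne (ht'.1.trans ht'.2.symm)⟩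

theorem IsStepPair.map {ι α β : Type*} [Finite ι] {a b : ι → Set.Icc (0 : ℝ) 1 → α}
    (h : ∀ i, IsStepPair (a i) (b i)) (F : (ι → α) → β) :
    IsStepPair (fun t => F fun i => a i t) (fun t => F fun i => b i t) := by
  intro t
  constructor
  · filter_upwards [Filter.eventually_all.mpr fun i => (h i t).1] with t' ht'
    exact ⟨congrArg F (funext fun i => (ht' i).1), congrArg F (funext fun i => (ht' i).2)⟩
  · filter_upwards [Filter.eventually_all.mpr fun i => (h i t).2] with t' ht'
    exact ⟨congrArg F (funext fun i => (ht' i).1), congrArg F (funext fun i => (ht' i).2)⟩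

/-- The product of the jumps of a piecewise constant function is the quotient of its values at
the ends: the function becomes locally constant when it is multiplied by its past jumps. -/
theorem IsStepPair.finprod_jumps {a b : Set.Icc (0 : ℝ) 1 → ℤˣ} (h : IsStepPair a b) :
    ∏ᶠ t, b t * a t = b 0 * a 1 := by
  have hfin := h.finite_jumps
  set T := hfin.toFinset with hT
  have hJ : ∀ t, t ∉ T → b t * a t = 1 := by
    intro t ht
    have : a t = b t := by simpa [hT] using ht
    rw [this, Int.units_mul_self]
  have hba : ∀ t, a t * (b t * a t) = b t := by
    intro t
    rw [mul_left_comm, Int.units_mul_self, mul_one]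
  -- the function times its past jumps, which is locally constant
  let G : Set.Icc (0 : ℝ) 1 → ℤˣ := fun t => a t * ∏ s ∈ T, if s ≤ t then b s * a s else 1
  have hG' : ∀ t, G t = b t * ∏ s ∈ T, if s < t then b s * a s else 1 := by
    intro t
    have hsplit : ∀ s, (if s ≤ t then b s * a s else 1) =
        (if t = s then b s * a s else 1) * (if s < t then b s * a s else 1) := by
      intro s
      rcases lt_trichotomy s t with hst | hst | hst
      · simp [hst.le, hst, hst.ne']
      · simp [hst]
      · simp [hst.not_ge, hst.not_gt, hst.ne]
    simp only [G, hsplit, Finset.prod_mul_distrib, Finset.prod_ite_eq]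
    split_ifs with ht
    · rw [← mul_assoc, hba]
    · rw [one_mul]
      have := hba t
      rw [hJ t ht, mul_one] at this
      rw [this]
  have hG : IsLocallyConstant G := by
    rw [IsLocallyConstant.iff_eventually_eq]
    intro t
    rw [← nhdsLT_sup_nhdsGE, ← Set.Ioi_insert, nhdsWithin_insert, Filter.eventually_sup,
      Filter.eventually_sup]
    refine ⟨?_, Filter.eventually_pure.mpr rfl, ?_⟩
    · have hT' : ∀ᶠ t' in 𝓝[<] t, ∀ s ∈ T, (s ≤ t' ↔ s < t) := by
        refine (Filter.eventually_all_finset T).mpr fun s _ => ?_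
        filter_upwards [self_mem_nhdsWithin,
          (Filter.eventually_imp_distrib_left.mpr fun hs : s < t =>
            (eventually_gt_nhds hs).filter_mono nhdsWithin_le_nhds)] with t' ht' hs
        exact ⟨fun hst => hst.trans_lt ht', fun hst => (hs hst).le⟩
      filter_upwards [(h t).2, hT'] with t' ht' hs
      rw [hG' t]
      simp only [G]
      rw [ht'.1]
      exact congrArg _ (Finset.prod_congr rfl fun s hsT => if_congr (hs s hsT) rfl rfl)
    · have hT' : ∀ᶠ t' in 𝓝[>] t, ∀ s ∈ T, (s ≤ t' ↔ s ≤ t) := by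
        refine (Filter.eventually_all_finset T).mpr fun s _ => ?_
        filter_upwards [self_mem_nhdsWithin,
          (Filter.eventually_imp_distrib_left.mpr fun hs : t < s =>
            (eventually_lt_nhds hs).filter_mono nhdsWithin_le_nhds)] with t' ht' hs
        refine ⟨fun hst => not_lt.mp fun h' => (hs h').not_ge hst, fun hst => hst.trans ?_⟩
        exact le_of_lt ht'
      filter_upwards [(h t).1, hT'] with t' ht' hs
      simp only [G]
      rw [ht'.1]
      exact congrArg _ (Finset.prod_congr rfl fun s hsT => if_congr (hs s hsT) rfl rfl)
  have h01 : G 0 = G 1 := hG.apply_eq_of_preconnectedSpace 0 1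
  have hG0 : G 0 = b 0 := by
    rw [hG', Finset.prod_eq_one, mul_one]
    intro s _
    exact if_neg s.2.1.not_gt
  have hG1 : G 1 = a 1 * ∏ s ∈ T, b s * a s := by
    refine congrArg (a 1 * ·) (Finset.prod_congr rfl fun s _ => ?_)
    exact if_pos s.2.2
  rw [finprod_eq_prod_of_mulSupport_subset (s := T) _ (fun t ht => by
    by_contra h'
    exact ht (hJ t h')), ← hG0, h01, hG1, mul_right_comm, Int.units_mul_self, one_mul]

/-- The tube lemma: over a neighbourhood of a point, the members of an open cover of `X × [0,1]`
can be chosen piecewise constantly in the direction of `[0,1]`, so that at each of the finitely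
many jumps both members contain the slice. -/
theorem exists_stepPair {X : Type*} [TopologicalSpace X] {ι : Type*}
    (W : ι → Opens (X × Set.Icc (0 : ℝ) 1)) (hW : ∀ p, ∃ i, p ∈ W i) (x : X) :
    ∃ (V : Opens X) (a b : Set.Icc (0 : ℝ) 1 → ι), x ∈ V ∧ IsStepPair a b ∧
      ∀ y ∈ V, ∀ t, (y, t) ∈ W (a t) ∧ (y, t) ∈ W (b t) := by
  have hloc : ∀ t : Set.Icc (0 : ℝ) 1, ∃ (i : ι) (V : Set X) (J : Set (Set.Icc (0 : ℝ) 1)),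
      IsOpen V ∧ IsOpen J ∧ x ∈ V ∧ t ∈ J ∧ V ×ˢ J ⊆ W i := by
    intro t
    obtain ⟨i, hi⟩ := hW (x, t)
    obtain ⟨V, J, hV, hJ, hx, ht, h⟩ := isOpen_prod_iff.mp (W i).isOpen x t hi
    exact ⟨i, V, J, hV, hJ, hx, ht, h⟩
  choose i V J hV hJ hx ht hVJ using hloc
  obtain ⟨τ, hτ0, hτm, ⟨N, hN⟩, hτ⟩ := exists_monotone_Icc_subset_open_cover_unitInterval hJ
    (fun t _ => Set.mem_iUnion.mpr ⟨t, ht t⟩)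
  choose k hk using hτ
  classical
  have hτ0' : ∀ t, τ 0 ≤ t := fun t => by rw [hτ0]; exact t.2.1
  have hB : ∀ t, ∃ m, t ≤ τ (m + 1) := fun t => ⟨N, by rw [hN _ (Nat.le_succ N)]; exact t.2.2⟩
  -- the numbers of the intervals of the partition just before and just after a point
  let b' : Set.Icc (0 : ℝ) 1 → ℕ := fun t => Nat.find (hB t)
  let a' : Set.Icc (0 : ℝ) 1 → ℕ := fun t => if h : ∃ m, t < τ (m + 1) then Nat.find h else b' t
  have hb' : ∀ t m, t ≤ τ (m + 1) → (∀ l < m, τ (l + 1) < t) → b' t = m := fun t m h1 h2 =>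
    (Nat.find_eq_iff _).mpr ⟨h1, fun l hl => (h2 l hl).not_ge⟩
  have ha' : ∀ t m, t < τ (m + 1) → (∀ l < m, τ (l + 1) ≤ t) → a' t = m := fun t m h1 h2 => by
    have h : ∃ m, t < τ (m + 1) := ⟨m, h1⟩
    simp only [a', dif_pos h]
    exact (Nat.find_eq_iff _).mpr ⟨h1, fun l hl => (h2 l hl).not_gt⟩
  -- for both choices, the slice at `t` lies in the chosen interval of the partition
  have hb : ∀ t, b' t ≤ N ∧ t ∈ Set.Icc (τ (b' t)) (τ (b' t + 1)) := by
    intro t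
    refine ⟨Nat.find_min' _ (by rw [hN _ (Nat.le_succ N)]; exact t.2.2), ?_, Nat.find_spec (hB t)⟩
    rcases Nat.eq_zero_or_pos (b' t) with h0 | h0
    · rw [h0]; exact hτ0' t
    · have := Nat.find_min (hB t) (Nat.sub_lt h0 one_pos)
      rw [show Nat.find (hB t) - 1 + 1 = Nat.find (hB t) from Nat.sub_add_cancel h0] at this
      exact (not_le.mp this).le
  have ha : ∀ t, a' t ≤ N ∧ t ∈ Set.Icc (τ (a' t)) (τ (a' t + 1)) := by
    intro t
    by_cases h : ∃ m, t < τ (m + 1)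
    · have he : a' t = Nat.find h := dif_pos h
      have ht := Nat.find_spec h
      have h1 : Nat.find h ≤ N := by
        refine Nat.find_min' _ ?_
        rw [hN _ (Nat.le_succ N)]
        exact ht.trans_le (τ _).2.2
      rw [he]
      refine ⟨h1, ?_, ht.le⟩
      rcases Nat.eq_zero_or_pos (Nat.find h) with h0 | h0
      · rw [h0]; exact hτ0' t
      · have := Nat.find_min h (Nat.sub_lt h0 one_pos)
        rw [show Nat.find h - 1 + 1 = Nat.find h from Nat.sub_add_cancel h0] at this
        exact not_lt.mp this
    · have he : a' t = b' t := dif_neg h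
      rw [he]
      exact hb t
  refine ⟨⟨⋂ m ∈ Finset.range (N + 1), V (k m),
      isOpen_biInter_finset fun m _ => hV _⟩, fun t => i (k (a' t)), fun t => i (k (b' t)), ?_,
      ?_, ?_⟩
  · exact Set.mem_iInter₂.mpr fun m _ => hx _
  · intro t
    have key : ∀ t' m, τ m < t' → t' < τ (m + 1) → a' t' = m ∧ b' t' = m := fun t' m h1 h2 =>
      ⟨ha' t' m h2 fun l hl => (hτm (Nat.succ_le_of_lt hl)).trans h1.le,
        hb' t' m h2.le fun l hl => (hτm (Nat.succ_le_of_lt hl)).trans_lt h1⟩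
    constructor
    · by_cases h : t < τ (a' t + 1)
      · filter_upwards [self_mem_nhdsWithin,
          (eventually_lt_nhds h).filter_mono nhdsWithin_le_nhds] with t' h1 h2
        obtain ⟨e1, e2⟩ := key t' (a' t) ((ha t).2.1.trans_lt h1) h2
        simp only [e1, e2, and_self]
      · -- `t = 1`, which has nothing on its right
        have h' : ¬ ∃ m, t < τ (m + 1) := by
          intro hm
          have he : a' t = Nat.find hm := dif_pos hm
          exact h (he ▸ Nat.find_spec hm)
        filter_upwards [self_mem_nhdsWithin] with t' h1
        refine absurd ⟨N, ?_⟩ h'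
        rw [hN _ (Nat.le_succ N)]
        exact lt_of_lt_of_le h1 t'.2.2
    · by_cases h : τ (b' t) < t
      · filter_upwards [self_mem_nhdsWithin,
          (eventually_gt_nhds h).filter_mono nhdsWithin_le_nhds] with t' h1 h2
        obtain ⟨e1, e2⟩ := key t' (b' t) h2 (lt_of_lt_of_le h1 (hb t).2.2)
        simp only [e1, e2, and_self]
      · -- `t = 0`, which has nothing on its left
        filter_upwards [self_mem_nhdsWithin] with t' h1
        exfalso
        rcases Nat.eq_zero_or_pos (b' t) with h0 | h0
        · rw [h0, hτ0] at h
          exact h (lt_of_le_of_lt t'.2.1 h1)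
        · have := Nat.find_min (hB t) (Nat.sub_lt h0 one_pos)
          rw [show Nat.find (hB t) - 1 + 1 = Nat.find (hB t) from Nat.sub_add_cancel h0] at this
          exact h (not_le.mp this)
  · intro y hy t
    have hy' : ∀ m ≤ N, y ∈ V (k m) := fun m hm =>
      Set.mem_iInter₂.mp hy m (Finset.mem_range.mpr (Nat.lt_succ_of_le hm))
    exact ⟨hVJ _ ⟨hy' _ (ha t).1, hk _ (ha t).2⟩, hVJ _ ⟨hy' _ (hb t).1, hk _ (hb t).2⟩⟩

/-! ### Homotopy invariance of Čech cohomology -/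

theorem prism_self {ι : Type*} (F : (Fin 4 → ι) → ℤˣ)
    (hinj : ∀ s, ¬ Function.Injective s → F s = 1) (a : Fin 3 → ι) : prism F a a = 1 := by
  rw [prism, hinj, hinj, hinj, one_mul, one_mul]
  · intro h
    exact absurd (@h 2 3 rfl) (by decide)
  · intro h
    exact absurd (@h 1 2 rfl) (by decide)
  · intro h
    exact absurd (@h 0 1 rfl) (by decide)

/-- Homotopy invariance of Čech cohomology, for a constant alternating cocycle on a cover of
`X × [0,1]`: on a common refinement of the covers of the two ends, the restrictions of the cocycle
differ by the differential of the product, over all jumps, of the values of the prism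
operator. -/
theorem exists_refinement_of_ends {X : Type u} [TopologicalSpace X]
    (𝒲 : OpenCover (X × Set.Icc (0 : ℝ) 1)) (F : (Fin 4 → 𝒲.ι) → ℤˣ)
    (hF : ∀ p (s : Fin 5 → 𝒲.ι), (∀ i, p ∈ 𝒲.U (s i)) → ∏ i : Fin 5, F (s ∘ i.succAbove) = 1)
    (hinj : ∀ s, ¬ Function.Injective s → F s = 1) :
    ∃ (𝒱 : OpenCover X) (ρ₀ ρ₁ : 𝒱.ι → 𝒲.ι) (h : (Fin 3 → 𝒱.ι) → ℤˣ),
      (∀ v, ∃ y, y ∈ 𝒱.U v) ∧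
      (∀ v, ∀ y ∈ 𝒱.U v, (y, 0) ∈ 𝒲.U (ρ₀ v)) ∧ (∀ v, ∀ y ∈ 𝒱.U v, (y, 1) ∈ 𝒲.U (ρ₁ v)) ∧
      ∀ (s : Fin 4 → 𝒱.ι), (∃ y, ∀ i, y ∈ 𝒱.U (s i)) →
        ∏ i : Fin 4, h (s ∘ i.succAbove) = F (ρ₀ ∘ s) * F (ρ₁ ∘ s) := by
  choose V a b hxV hab hV using exists_stepPair 𝒲.U 𝒲.exists_mem
  refine ⟨⟨X, V, fun x => ⟨x, hxV x⟩⟩, fun v => b v 0, fun v => a v 1,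
    fun s => ∏ᶠ t, prism F (fun i => b (s i) t) (fun i => a (s i) t), fun v => ⟨v, hxV v⟩,
    fun v y hy => (hV v y hy 0).2, fun v y hy => (hV v y hy 1).1, ?_⟩
  rintro s ⟨y, hy⟩
  have hsupp : ∀ r : Fin 3 → X, (Function.mulSupport fun t =>
      prism F (fun i => b (r i) t) (fun i => a (r i) t)).Finite := by
    intro r
    refine (Set.finite_iUnion fun i => (hab (r i)).finite_jumps).subset fun t ht => ?_
    by_contra hne
    refine ht ?_
    have he : (fun i => a (r i) t) = fun i => b (r i) t := by
      funext i
      by_contra h'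
      exact hne (Set.mem_iUnion.mpr ⟨i, h'⟩)
    show prism F _ _ = 1
    rw [he]
    exact prism_self F hinj _
  have hprod := finprod_prod_comm Finset.univ
    (fun (t : Set.Icc (0 : ℝ) 1) (i : Fin 4) =>
      prism F (fun j => b ((s ∘ i.succAbove) j) t) (fun j => a ((s ∘ i.succAbove) j) t))
    (fun i _ => hsupp (s ∘ i.succAbove))
  refine hprod.symm.trans ?_
  refine Eq.trans (finprod_congr fun t => ?_)
    (IsStepPair.map (fun i => hab (s i)) F).finprod_jumps
  exact prod_prism F {α | (y, t) ∈ 𝒲.U α} (fun r hr => hF (y, t) r hr) (fun i => b (s i) t)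
    (fun i => a (s i) t) (fun i => (hV (s i) y (hy i) t).2) (fun i => (hV (s i) y (hy i) t).1)

section Bundles

variable {E : Type*} [NormedAddCommGroup E] [NormedSpace ℝ E] {H : Type*} [TopologicalSpace H]
variable {I : ModelWithCorners ℝ E H} {X : Type u} [TopologicalSpace X] [ChartedSpace H X]

namespace TwoVectorBundle

/-- A cover of `X` that refines the slice at `t` of the cover of a bundle over `X × [0,1]` refines
the cover of the restriction, and the signs of the two bundles agree on it. -/
theorem RestrictsTo.exists_refinement {𝓔 : TwoVectorBundle (I.prod (𝓡∂ 1))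
    (X × Set.Icc (0 : ℝ) 1) n} {t : Set.Icc (0 : ℝ) 1} {𝓔' : TwoVectorBundle I X n}
    (h : 𝓔.RestrictsTo t 𝓔') (𝒱 : OpenCover X) (ρ : 𝒱.ι → 𝓔.cover.ι)
    (hne : ∀ v, ∃ y, y ∈ 𝒱.U v) (hρ : ∀ v, ∀ y ∈ 𝒱.U v, (y, t) ∈ 𝓔.cover.U (ρ v)) :
    ∃ r : 𝓔'.cover.toOpenCover.Refinement 𝒱, ∀ (s : Fin 4 → 𝒱.ι) (x : 𝒱.inter s),
      r.pullback 𝓔'.sgnCochain s x = 𝓔.sgnValue (ρ ∘ s) := by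
  obtain ⟨e, hU, hobj, -⟩ := h
  have hρ' : ∀ v, ∃ x, (x, t) ∈ 𝓔.cover.U (ρ v) := fun v => (hne v).imp fun y hy => hρ v y hy
  let q : 𝒱.ι → {α : 𝓔'.cover.ι // ∃ x, x ∈ 𝓔'.cover.U α} := fun v => e.symm ⟨ρ v, hρ' v⟩
  have hq : ∀ v, (e (q v)).1 = ρ v := fun v => by simp [q]
  have hqU : ∀ v, ∀ y ∈ 𝒱.U v, y ∈ 𝓔'.cover.U (q v).1 := by
    intro v y hy
    rw [hU, hq]
    exact hρ v y hy
  refine ⟨⟨fun v => (q v).1, fun v y hy => hqU v y hy⟩, ?_⟩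
  rintro s ⟨x, hx⟩
  rw [OpenCover.Refinement.pullback_apply]
  refine (𝓔'.sgnCochain_apply _ _).trans ?_
  have hes : ρ ∘ s = fun i => (e (q (s i))).1 := funext fun i => (hq (s i)).symm
  rw [hes]
  by_cases hσ : ∃ σ : Equiv.Perm (Fin 4), StrictMono (fun i => q (s (σ i)))
  · obtain ⟨σ, hσ⟩ := hσ
    have h1 : StrictMono ((fun i => (q (s i)).1) ∘ σ) := fun i j hij => hσ hij
    have h2 : StrictMono ((fun i => (e (q (s i))).1) ∘ σ) := fun i j hij => e.strictMono (hσ hij)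
    refine (𝓔'.sgnValue_of_strictMono_comp (σ := σ) h1).trans ?_
    rw [𝓔.sgnValue_of_strictMono_comp h2]
    unfold chainSgn sgn
    have hm : ∀ i, x ∈ 𝓔'.cover.U (q (s (σ i))).1 := fun i => hqU _ x (hx (σ i))
    have o1 := hobj _ _ (hσ (show (0 : Fin 4) < 1 by decide)) x (hm 0) (hm 1)
    have o2 := hobj _ _ (hσ (show (1 : Fin 4) < 2 by decide)) x (hm 1) (hm 2)
    have o3 := hobj _ _ (hσ (show (2 : Fin 4) < 3 by decide)) x (hm 2) (hm 3)
    refine Eq.trans ?_ (congr (congrArg₂ assocSgn o1 o2) o3)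
    rfl
  · rw [𝓔.sgnValue_of_not_exists, 𝓔'.sgnValue_of_not_exists]
    · rintro ⟨σ, h1⟩
      exact hσ ⟨σ, fun i j hij => h1 hij⟩
    · rintro ⟨σ, h1⟩
      exact hσ ⟨σ, fun i j hij => e.lt_iff_lt.mp (h1 hij)⟩

/-- Equivalent bundles have the same class. -/
theorem Equivalent.cechClass_eq {𝓔₀ 𝓔₁ : TwoVectorBundle I X n} (h : 𝓔₀.Equivalent 𝓔₁) :
    cechClass 𝓔₀.cover.toOpenCover 𝓔₀.sgnCochain 𝓔₀.isCocycle_sgnCochain =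
      cechClass 𝓔₁.cover.toOpenCover 𝓔₁.sgnCochain 𝓔₁.isCocycle_sgnCochain := by
  obtain ⟨𝓔, -, h₀, h₁⟩ := h
  obtain ⟨𝒱, ρ₀, ρ₁, k, hne, hρ₀, hρ₁, hk⟩ := exists_refinement_of_ends 𝓔.cover.toOpenCover
    𝓔.sgnValue 𝓔.prod_sgnValue 𝓔.sgnValue_of_not_injective
  obtain ⟨r₀, hr₀⟩ := h₀.exists_refinement 𝒱 ρ₀ hne hρ₀
  obtain ⟨r₁, hr₁⟩ := h₁.exists_refinement 𝒱 ρ₁ hne hρ₁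
  have hcoc : 𝒱.IsCocycle (r₀.pullback 𝓔₀.sgnCochain) := by
    have h := r₀.pullback_δ 𝓔₀.sgnCochain
    rw [𝓔₀.isCocycle_sgnCochain] at h
    exact h.symm
  have e₀ : CechRel X 3 ⟨_, 𝓔₀.sgnCochain, 𝓔₀.isCocycle_sgnCochain⟩
      ⟨𝒱, r₀.pullback 𝓔₀.sgnCochain, hcoc⟩ := by
    refine ⟨r₀, ?_⟩
    rw [mul_inv_cancel]
    exact 𝒱.isCoboundary_one
  have e₁ : CechRel X 3 ⟨_, 𝓔₁.sgnCochain, 𝓔₁.isCocycle_sgnCochain⟩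
      ⟨𝒱, r₀.pullback 𝓔₀.sgnCochain, hcoc⟩ := by
    refine ⟨r₁, fun s => LocallyConstant.const _ (k s), OpenCover.cochain_ext fun s x hx => ?_⟩
    rw [OpenCover.δ_apply, OpenCover.inv_eq_self]
    refine (hk s ⟨x, hx⟩).trans ?_
    rw [← hr₀ s ⟨x, hx⟩, ← hr₁ s ⟨x, hx⟩, mul_comm]
    rfl
  exact (Quot.sound e₀).trans (Quot.sound e₁).symm

end TwoVectorBundle

end Bundles

/-! ### Oriented bundles have trivial signs -/

section Bundles

variable {E : Type*} [NormedAddCommGroup E] [NormedSpace ℝ E] {H : Type*} [TopologicalSpace H]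
variable {I : ModelWithCorners ℝ E H} {X : Type u} [TopologicalSpace X] [ChartedSpace H X]

namespace OrientedTwoVectorBundle

/-- The sign of the coherency map of a chain of three indices. -/
def chainSign (𝓔 : OrientedTwoVectorBundle I X n) (s : Fin 3 → 𝓔.cover.ι) (hs : StrictMono s)
    (x : X) (hx : ∀ i, x ∈ 𝓔.cover.U (s i)) : ℤˣ :=
  (𝓔.φ (hs (show (0 : Fin 3) < 1 by decide)) (hs (show (1 : Fin 3) < 2 by decide))
    ⟨x, ⟨hx 0, hx 1⟩, hx 2⟩).2

theorem chainSign_congr (𝓔 : OrientedTwoVectorBundle I X n) {s t : Fin 3 → 𝓔.cover.ι} (h : s = t)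
    (hs : StrictMono s) (ht : StrictMono t) (x : X) (hx : ∀ i, x ∈ 𝓔.cover.U (s i))
    (hx' : ∀ i, x ∈ 𝓔.cover.U (t i)) : 𝓔.chainSign s hs x hx = 𝓔.chainSign t ht x hx' := by
  subst h; rfl

open Classical in
/-- The signs of the coherency maps, as an alternating Čech 2-cochain. -/
def signCochain (𝓔 : OrientedTwoVectorBundle I X n) : 𝓔.cover.toOpenCover.Cochain 2 := fun s =>
  if h : ∃ σ : Equiv.Perm (Fin 3), StrictMono (s ∘ σ) then
    { toFun := fun x => 𝓔.chainSign _ h.choose_spec x.1 fun i => x.2 (h.choose i)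
      isLocallyConstant := by
        have hl := (𝓔.smooth (h.choose_spec (show (0 : Fin 3) < 1 by decide))
          (h.choose_spec (show (1 : Fin 3) < 2 by decide))).2
        exact hl.comp_continuous (f := fun x : 𝓔.cover.inter s =>
          ⟨x.1, ⟨x.2 (h.choose 0), x.2 (h.choose 1)⟩, x.2 (h.choose 2)⟩)
          (continuous_subtype_val.subtype_mk _) }
  else 1

theorem signCochain_apply (𝓔 : OrientedTwoVectorBundle I X n) {s : Fin 3 → 𝓔.cover.ι}
    {σ : Equiv.Perm (Fin 3)} (hσ : StrictMono (s ∘ σ)) (x : X) (hx : x ∈ 𝓔.cover.inter s) :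
    𝓔.signCochain s ⟨x, hx⟩ = 𝓔.chainSign _ hσ x fun i => hx (σ i) := by
  have h : ∃ σ : Equiv.Perm (Fin 3), StrictMono (s ∘ σ) := ⟨σ, hσ⟩
  rw [signCochain, dif_pos h]
  exact 𝓔.chainSign_congr (by rw [perm_unique_of_strictMono h.choose_spec hσ]) h.choose_spec hσ x
    (fun i => hx (h.choose i)) _

theorem signCochain_of_not_exists (𝓔 : OrientedTwoVectorBundle I X n) {s : Fin 3 → 𝓔.cover.ι}
    (hs : ¬ ∃ σ : Equiv.Perm (Fin 3), StrictMono (s ∘ σ)) : 𝓔.signCochain s = 1 := dif_neg hs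

theorem signCochain_at_of_not_exists (𝓔 : OrientedTwoVectorBundle I X n) (x : X)
    {s : Fin 3 → 𝓔.cover.ι} (hs : ¬ ∃ σ : Equiv.Perm (Fin 3), StrictMono (s ∘ σ)) :
    𝓔.signCochain.at x s = 1 := by
  rw [OpenCover.Cochain.at, 𝓔.signCochain_of_not_exists hs]
  split_ifs <;> rfl

theorem signCochain_at_comp_perm (𝓔 : OrientedTwoVectorBundle I X n) (x : X)
    (s : Fin 3 → 𝓔.cover.ι) (τ : Equiv.Perm (Fin 3)) :
    𝓔.signCochain.at x (s ∘ τ) = 𝓔.signCochain.at x s := by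
  by_cases h : ∃ σ : Equiv.Perm (Fin 3), StrictMono (s ∘ σ)
  · obtain ⟨σ, hσ⟩ := h
    by_cases hx : x ∈ 𝓔.cover.inter s
    · have hx' : x ∈ 𝓔.cover.inter (s ∘ τ) := fun i => hx (τ i)
      have he : (s ∘ τ) ∘ (τ⁻¹ * σ : Equiv.Perm (Fin 3)) = s ∘ σ := by
        funext i; simp
      rw [← OpenCover.Cochain.at_of_mem _ hx, ← OpenCover.Cochain.at_of_mem _ hx',
        𝓔.signCochain_apply hσ,
        𝓔.signCochain_apply (s := s ∘ τ) (σ := τ⁻¹ * σ) (by rwa [he])]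
      exact 𝓔.chainSign_congr he _ _ _ _ _
    · have hx' : x ∉ 𝓔.cover.inter (s ∘ τ) := fun h' => hx fun i => by
        simpa using h' (τ⁻¹ i)
      rw [OpenCover.Cochain.at, OpenCover.Cochain.at, dif_neg hx, dif_neg hx']
  · rw [𝓔.signCochain_at_of_not_exists x h, 𝓔.signCochain_at_of_not_exists]
    rintro ⟨σ, hσ⟩
    exact h ⟨τ * σ, hσ⟩

/-- The signs of the coherency maps of an oriented bundle exhibit the signs of the associators as
a coboundary. -/
theorem δ_signCochain (𝓔 : OrientedTwoVectorBundle I X n) :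
    𝓔.cover.toOpenCover.δ 𝓔.signCochain = 𝓔.forget.sgnCochain := by
  refine OpenCover.cochain_ext fun s x hx => ?_
  rw [OpenCover.δ_apply]
  refine (Finset.prod_congr rfl fun i _ => OpenCover.Cochain.at_of_mem _ _).trans ?_
  refine Eq.trans ?_ (𝓔.forget.sgnCochain_apply s ⟨x, hx⟩).symm
  refine prod_succAbove_eq (𝓔.signCochain.at x) 𝓔.forget.sgnValue
    (𝓔.signCochain_at_comp_perm x) (fun t ht => 𝓔.signCochain_at_of_not_exists x
      fun ⟨σ, hσ⟩ => ht ((Equiv.injective_comp σ t).mp hσ.injective))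
    𝓔.forget.sgnValue_comp_perm 𝓔.forget.sgnValue_of_not_injective s
    (fun i j => 𝓔.cover.total _ _ x (hx i) (hx j)) fun σ hσ => ?_
  have hx' : ∀ i, x ∈ 𝓔.cover.U ((s ∘ σ) i) := fun i => hx (σ i)
  generalize s ∘ σ = t at hσ hx'
  have hface : ∀ i : Fin 4, 𝓔.signCochain.at x (t ∘ i.succAbove) =
      𝓔.chainSign (t ∘ i.succAbove) (hσ.comp (Fin.strictMono_succAbove i)) x
        fun j => hx' (i.succAbove j) := fun i => by
    rw [← OpenCover.Cochain.at_of_mem _ (s := t ∘ i.succAbove) fun j => hx' (i.succAbove j)]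
    exact 𝓔.signCochain_apply (σ := 1) (hσ.comp (Fin.strictMono_succAbove i)) x _
  rw [Fin.prod_univ_four, hface, hface, hface, hface, 𝓔.forget.sgnValue_of_strictMono hσ]
  have h := congrArg Prod.snd (𝓔.coherent (hσ (show (0 : Fin 4) < 1 by decide))
    (hσ (show (1 : Fin 4) < 2 by decide)) (hσ (show (2 : Fin 4) < 3 by decide)) x
    (hx' 0) (hx' 1) (hx' 2) (hx' 3))
  have h' : 𝓔.forget.chainSgn t hσ *
      ((𝓔.chainSign (t ∘ Fin.succAbove 3) (hσ.comp (Fin.strictMono_succAbove 3)) x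
          fun j => hx' (Fin.succAbove 3 j)) * 1 *
        (𝓔.chainSign (t ∘ Fin.succAbove 1) (hσ.comp (Fin.strictMono_succAbove 1)) x
          fun j => hx' (Fin.succAbove 1 j))) =
      1 * (𝓔.chainSign (t ∘ Fin.succAbove 0) (hσ.comp (Fin.strictMono_succAbove 0)) x
          fun j => hx' (Fin.succAbove 0 j)) *
        (𝓔.chainSign (t ∘ Fin.succAbove 2) (hσ.comp (Fin.strictMono_succAbove 2)) x
          fun j => hx' (Fin.succAbove 2 j)) := h
  generalize 𝓔.chainSign _ _ _ _ = a at *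
  generalize 𝓔.chainSign _ _ _ _ = b at *
  generalize 𝓔.chainSign _ _ _ _ = c at *
  generalize 𝓔.chainSign _ _ _ _ = d at *
  generalize 𝓔.forget.chainSgn t hσ = e at *
  clear * - h'
  revert a b c d e
  decide

end OrientedTwoVectorBundle

/-- Orientable bundles have a trivial class. -/
theorem TwoVectorBundle.Orientable.cechClass_eq_one {𝓔 : TwoVectorBundle I X n}
    (h : 𝓔.Orientable) :
    cechClass 𝓔.cover.toOpenCover 𝓔.sgnCochain 𝓔.isCocycle_sgnCochain = 1 := by
  obtain ⟨𝓔', h⟩ := h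
  rw [h.cechClass_eq]
  exact OpenCover.cechClass_eq_one _ _ _ ⟨𝓔'.signCochain, 𝓔'.δ_signCochain⟩

end Bundles

/-! ### Transport of morphisms along equalities of objects -/

/-- A morphism, regarded as a morphism between equal objects. -/
def Mor.cast {A A' B B' : Obj n} (hA : A = A') (hB : B = B') (f : Mor A B) : Mor A' B' :=
  hA ▸ hB ▸ f

theorem Mor.cast_heq {A A' B B' : Obj n} (hA : A = A') (hB : B = B') (f : Mor A B) :
    HEq (Mor.cast hA hB f) f := by
  subst hA hB; rfl

theorem coherent_cast {A A' B B' C C' P P' Q Q' R R' : Obj n} (hA : A = A') (hB : B = B')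
    (hC : C = C') (hP : P = P') (hQ : Q = Q') (hR : R = R')
    (f : Mor (A * B) P) (g : Mor (P * C) R) (h : Mor (B * C) Q) (k : Mor (A * Q) R)
    (hcoh : (assoc A B C).comp ((f.mul (Mor.id C)).comp g) = ((Mor.id A).mul h).comp k) :
    (assoc A' B' C').comp (((f.cast (congrArg₂ (· * ·) hA hB) hP).mul (Mor.id C')).comp
        (g.cast (congrArg₂ (· * ·) hP hC) hR)) =
      ((Mor.id A').mul (h.cast (congrArg₂ (· * ·) hB hC) hQ)).comp
        (k.cast (congrArg₂ (· * ·) hA hQ) hR) := by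
  subst hA hB hC hP hQ hR
  exact hcoh

section Smooth

variable {E : Type*} [NormedAddCommGroup E] [NormedSpace ℝ E] {H : Type*} [TopologicalSpace H]
variable {I : ModelWithCorners ℝ E H} {X : Type*} [TopologicalSpace X] [ChartedSpace H X]
variable {E' : Type*} [NormedAddCommGroup E'] [NormedSpace ℝ E'] {H' : Type*}
  [TopologicalSpace H'] {J : ModelWithCorners ℝ E' H'} {Y : Type*} [TopologicalSpace Y]
  [ChartedSpace H' Y]

theorem SmoothMor.cast {A A' B B' : Obj n} (hA : A = A') (hB : B = B') {f : X → Mor A B}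
    (hf : SmoothMor I f) : SmoothMor I fun x => (f x).cast hA hB := by
  subst hA hB; exact hf

theorem smoothMor_const {A B : Obj n} (f : Mor A B) : SmoothMor I fun _ : X => f :=
  fun _ _ _ _ => contMDiff_const

theorem SmoothMor.comp_open {A B : Obj n} {U : Opens X} {f : U → Mor A B} (hf : SmoothMor I f)
    {g : Y → X} (hg : ContMDiff J I ∞ g) (hgU : ∀ y, g y ∈ U) :
    SmoothMor J fun y => f ⟨g y, hgU y⟩ := by
  intro i j p q y
  classical
  -- the entry, extended by zero to all of `X`
  let F : X → ℂ := fun x => if hx : x ∈ U then f ⟨x, hx⟩ i j (Pi.single q 1) p else 0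
  have hF : ∀ x : U, F x = f x i j (Pi.single q 1) p := fun x => dif_pos x.2
  have h1 : ContMDiffAt I 𝓘(ℝ, ℂ) ∞ F ((⟨g y, hgU y⟩ : U) : X) := by
    rw [← contMDiffAt_subtype_iff]
    simp only [hF]
    exact hf i j p q _
  have h2 : ContMDiffAt J 𝓘(ℝ, ℂ) ∞ (F ∘ g) y := ContMDiffAt.comp y h1 (hg y)
  refine h2.congr_of_eventuallyEq (Filter.Eventually.of_forall fun y' => ?_)
  exact (hF ⟨g y', hgU y'⟩).symm

end Smooth

/-! ### Pullbacks of bundles to refined covers -/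

section Bundles

variable {E : Type*} [NormedAddCommGroup E] [NormedSpace ℝ E] {H : Type*} [TopologicalSpace H]
variable {I : ModelWithCorners ℝ E H} {X : Type u} [TopologicalSpace X] [ChartedSpace H X]

namespace TwoVectorBundle

variable (𝓔 : TwoVectorBundle I X n)

open Classical in
/-- The objects of a bundle, extended by the unit object to all pairs of indices. -/
def extObj (α β : 𝓔.cover.ι) : Obj n := if h : α < β then 𝓔.obj h else 1

variable {𝓔} {α β γ δ : 𝓔.cover.ι}

theorem extObj_of_lt (h : α < β) : 𝓔.extObj α β = 𝓔.obj h := dif_pos h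

theorem extObj_of_eq (h : α = β) : 𝓔.extObj α β = 1 := dif_neg h.not_lt

theorem weaklyInvertible_extObj : WeaklyInvertible (𝓔.extObj α β) := by
  unfold extObj
  split_ifs with h
  · exact 𝓔.weaklyInvertible h
  · simp [WeaklyInvertible, objDet]

theorem extObj_mul (hαβ : α ≤ β) (hβγ : β ≤ γ) {x : X}
    (hx : x ∈ 𝓔.cover.U α ⊓ 𝓔.cover.U β ⊓ 𝓔.cover.U γ) :
    𝓔.extObj α β * 𝓔.extObj β γ = 𝓔.extObj α γ := by
  rcases hαβ.eq_or_lt with rfl | h₁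
  · rw [extObj_of_eq (rfl : α = α), one_mul]
  rcases hβγ.eq_or_lt with rfl | h₂
  · rw [extObj_of_eq (rfl : β = β), mul_one]
  rw [extObj_of_lt h₁, extObj_of_lt h₂, extObj_of_lt (h₁.trans h₂)]
  exact 𝓔.obj_mul h₁ h₂ ⟨x, hx⟩

open Classical in
/-- The coherency maps of a bundle, extended by the unitors to weakly increasing triples of
indices. -/
def extφ (hαβ : α ≤ β) (hβγ : β ≤ γ) (x : X) (hα : x ∈ 𝓔.cover.U α) (hβ : x ∈ 𝓔.cover.U β)
    (hγ : x ∈ 𝓔.cover.U γ) :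
    Mor (𝓔.extObj α β * 𝓔.extObj β γ) (𝓔.extObj α γ) :=
  if h₁ : α = β then
    (leftUnitor (extObj_of_eq h₁) (𝓔.extObj β γ)).cast rfl (by rw [h₁])
  else if h₂ : β = γ then
    (rightUnitor (extObj_of_eq h₂) (𝓔.extObj α β)).cast rfl (by rw [h₂])
  else
    (𝓔.φ (lt_of_le_of_ne hαβ h₁) (lt_of_le_of_ne hβγ h₂) ⟨x, ⟨hα, hβ⟩, hγ⟩).cast
      (congrArg₂ (· * ·) (extObj_of_lt _).symm (extObj_of_lt _).symm) (extObj_of_lt _).symm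

theorem extφ_refl_left (h : α ≤ γ) (x : X) (hα hα' : x ∈ 𝓔.cover.U α)
    (hγ : x ∈ 𝓔.cover.U γ) :
    extφ le_rfl h x hα hα' hγ = leftUnitor (extObj_of_eq rfl) (𝓔.extObj α γ) := dif_pos rfl

theorem extφ_refl_right (h : α < β) (x : X) (hα : x ∈ 𝓔.cover.U α)
    (hβ hβ' : x ∈ 𝓔.cover.U β) :
    extφ h.le le_rfl x hα hβ hβ' = rightUnitor (extObj_of_eq rfl) (𝓔.extObj α β) := by
  rw [extφ, dif_neg h.ne, dif_pos rfl]
  rfl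

theorem extφ_of_lt (h₁ : α < β) (h₂ : β < γ) (x : X) (hα : x ∈ 𝓔.cover.U α)
    (hβ : x ∈ 𝓔.cover.U β) (hγ : x ∈ 𝓔.cover.U γ) :
    extφ h₁.le h₂.le x hα hβ hγ = (𝓔.φ h₁ h₂ ⟨x, ⟨hα, hβ⟩, hγ⟩).cast
      (congrArg₂ (· * ·) (extObj_of_lt h₁).symm (extObj_of_lt h₂).symm)
      (extObj_of_lt (h₁.trans h₂)).symm := by
  rw [extφ, dif_neg h₁.ne, dif_neg h₂.ne]

/-- The extended coherency maps are coherent: for indices that are not distinct, this is one of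
the triangle identities, together with the naturality of the unitors. -/
theorem extφ_coherent (hαβ : α ≤ β) (hβγ : β ≤ γ) (hγδ : γ ≤ δ) (x : X)
    (hα : x ∈ 𝓔.cover.U α) (hβ : x ∈ 𝓔.cover.U β) (hγ : x ∈ 𝓔.cover.U γ)
    (hδ : x ∈ 𝓔.cover.U δ) :
    (assoc (𝓔.extObj α β) (𝓔.extObj β γ) (𝓔.extObj γ δ)).comp
        (((extφ hαβ hβγ x hα hβ hγ).mul (Mor.id (𝓔.extObj γ δ))).comp
          (extφ (hαβ.trans hβγ) hγδ x hα hγ hδ)) =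
      ((Mor.id (𝓔.extObj α β)).mul (extφ hβγ hγδ x hβ hγ hδ)).comp
        (extφ hαβ (hβγ.trans hγδ) x hα hβ hδ) := by
  rcases hαβ.eq_or_lt with rfl | h₁
  · rw [extφ_refl_left hβγ, extφ_refl_left (hβγ.trans hγδ),
      leftUnitor_naturality, ← Mor.comp_assoc, triangle_left]
  rcases hβγ.eq_or_lt with rfl | h₂
  · rw [extφ_refl_right h₁, extφ_refl_left hγδ, ← Mor.comp_assoc, triangle_middle]
  rcases hγδ.eq_or_lt with rfl | h₃
  · rw [extφ_refl_right (h₁.trans h₂), extφ_refl_right h₂, rightUnitor_naturality,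
      ← Mor.comp_assoc, triangle_right]
  rw [extφ_of_lt h₁ h₂, extφ_of_lt (h₁.trans h₂) h₃, extφ_of_lt h₂ h₃,
    extφ_of_lt h₁ (h₂.trans h₃)]
  exact coherent_cast (extObj_of_lt h₁).symm (extObj_of_lt h₂).symm (extObj_of_lt h₃).symm
    (extObj_of_lt _).symm (extObj_of_lt _).symm (extObj_of_lt _).symm _ _ _ _
    (𝓔.coherent h₁ h₂ h₃ x hα hβ hγ hδ)

/-- The signs of the associators for weakly increasing indices. -/
theorem assocSgn_extObj {s : Fin 4 → 𝓔.cover.ι} (hs : Monotone s) :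
    assocSgn (𝓔.extObj (s 0) (s 1)) (𝓔.extObj (s 1) (s 2)) (𝓔.extObj (s 2) (s 3)) =
      𝓔.sgnValue s := by
  rcases (hs (show (0 : Fin 4) ≤ 1 by decide)).eq_or_lt with h₁ | h₁
  · rw [assocSgn_one_left (extObj_of_eq h₁), sgnValue_of_not_injective]
    exact fun h => absurd (h h₁) (by decide)
  rcases (hs (show (1 : Fin 4) ≤ 2 by decide)).eq_or_lt with h₂ | h₂
  · rw [assocSgn_one_middle (extObj_of_eq h₂), sgnValue_of_not_injective]
    exact fun h => absurd (h h₂) (by decide)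
  rcases (hs (show (2 : Fin 4) ≤ 3 by decide)).eq_or_lt with h₃ | h₃
  · rw [assocSgn_one_right (extObj_of_eq h₃), sgnValue_of_not_injective]
    exact fun h => absurd (h h₃) (by decide)
  have hs' : StrictMono s := by
    rw [Fin.strictMono_iff_lt_succ]
    intro i
    fin_cases i <;> assumption
  rw [extObj_of_lt h₁, extObj_of_lt h₂, extObj_of_lt h₃, 𝓔.sgnValue_of_strictMono hs']
  rfl

variable {E' : Type*} [NormedAddCommGroup E'] [NormedSpace ℝ E'] {H' : Type*}
  [TopologicalSpace H'] {J : ModelWithCorners ℝ E' H'} {Y : Type u} [TopologicalSpace Y]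
  [ChartedSpace H' Y]

theorem smooth_extφ (hαβ : α ≤ β) (hβγ : β ≤ γ) {π : Y → X} (hπ : ContMDiff J I ∞ π)
    {O : Opens Y} (hO : ∀ y ∈ O, π y ∈ 𝓔.cover.U α ⊓ 𝓔.cover.U β ⊓ 𝓔.cover.U γ) :
    SmoothMor J fun y : O => extφ hαβ hβγ (π y) (hO y y.2).1.1 (hO y y.2).1.2 (hO y y.2).2 := by
  rcases hαβ.eq_or_lt with rfl | h₁
  · simp only [extφ_refl_left hβγ]
    exact smoothMor_const _
  rcases hβγ.eq_or_lt with rfl | h₂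
  · simp only [extφ_refl_right h₁]
    exact smoothMor_const _
  simp only [extφ_of_lt h₁ h₂]
  exact ((𝓔.smooth h₁ h₂).comp_open (hπ.comp contMDiff_subtype_val) fun y => hO y y.2).cast _ _

variable (𝓔) in
/-- The pullback of a bundle along a smooth map, over an ordered cover that refines the preimage
of its cover by a monotone map of indices. Indices over the same member of the cover are
connected by the unit object. -/
def pull {π : Y → X} (hπ : ContMDiff J I ∞ π) (𝒲 : OrderedOpenCover Y) {ρ : 𝒲.ι → 𝓔.cover.ι}
    (hρ : Monotone ρ) (hU : ∀ a, ∀ y ∈ 𝒲.U a, π y ∈ 𝓔.cover.U (ρ a)) :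
    TwoVectorBundle J Y n where
  cover := 𝒲
  obj {a b} _ := 𝓔.extObj (ρ a) (ρ b)
  weaklyInvertible _ := weaklyInvertible_extObj
  obj_mul hab hbc := fun ⟨y, hy⟩ =>
    extObj_mul (hρ hab.le) (hρ hbc.le) ⟨⟨hU _ y hy.1.1, hU _ y hy.1.2⟩, hU _ y hy.2⟩
  φ hab hbc y := extφ (hρ hab.le) (hρ hbc.le) (π y)
    (hU _ _ y.2.1.1) (hU _ _ y.2.1.2) (hU _ _ y.2.2)
  smooth hab hbc := smooth_extφ (hρ hab.le) (hρ hbc.le) hπ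
    fun y (hy : y ∈ 𝒲.U _ ⊓ 𝒲.U _ ⊓ 𝒲.U _) => ⟨⟨hU _ y hy.1.1, hU _ y hy.1.2⟩, hU _ y hy.2⟩
  coherent hab hbc hcd y ha hb hc hd := extφ_coherent (hρ hab.le) (hρ hbc.le) (hρ hcd.le) (π y)
    (hU _ y ha) (hU _ y hb) (hU _ y hc) (hU _ y hd)

end TwoVectorBundle

end Bundles

/-! ### The cobordism between a bundle and its pullback to a refined cover -/

section Covers

open Classical in
/-- A linear order on an arbitrary type. -/
abbrev chosenLinearOrder (K : Type*) : LinearOrder K := linearOrderOfSTO WellOrderingRel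

/-- The lexicographic order on the source of a map to a partially ordered set; the elements of a
fibre are ordered by an arbitrary linear order. -/
abbrev fibreOrder {K P : Type*} [PartialOrder P] (ρ : K → P) : PartialOrder K :=
  letI : LinearOrder K := chosenLinearOrder K
  PartialOrder.lift (fun a => toLex (ρ a, a)) fun _ _ h => congrArg Prod.snd (toLex.injective h)

theorem fibreOrder_le_of_lt {K P : Type*} [PartialOrder P] (ρ : K → P) {a b : K} (h : ρ a < ρ b) :
    (fibreOrder ρ).le a b := by
  let _ : LinearOrder K := chosenLinearOrder K
  exact Prod.Lex.toLex_le_toLex.mpr (Or.inl h)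

theorem le_of_fibreOrder_le {K P : Type*} [PartialOrder P] (ρ : K → P) {a b : K}
    (h : (fibreOrder ρ).le a b) : ρ a ≤ ρ b := by
  let _ : LinearOrder K := chosenLinearOrder K
  exact (Prod.Lex.toLex_le_toLex.mp h).elim le_of_lt fun h => h.1.le

theorem fibreOrder_total {K P : Type*} [PartialOrder P] (ρ : K → P) {a b : K}
    (h : ρ a ≤ ρ b ∨ ρ b ≤ ρ a) : (fibreOrder ρ).le a b ∨ (fibreOrder ρ).le b a := by
  let _ : LinearOrder K := chosenLinearOrder K
  by_cases he : ρ a = ρ b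
  · exact (le_total a b).imp (fun h => Prod.Lex.toLex_le_toLex.mpr (Or.inr ⟨he, h⟩))
      fun h => Prod.Lex.toLex_le_toLex.mpr (Or.inr ⟨he.symm, h⟩)
  · exact h.imp (fun h => fibreOrder_le_of_lt ρ (lt_of_le_of_ne h he))
      fun h => fibreOrder_le_of_lt ρ (lt_of_le_of_ne h (Ne.symm he))

variable {X : Type u} [TopologicalSpace X]

namespace OrderedOpenCover

variable (𝒰 : OrderedOpenCover X) {𝒱 : OpenCover X} (r : 𝒰.toOpenCover.Refinement 𝒱)

/-- The order on the indices of a cover and of a refinement that is used for the cobordism. -/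
abbrev sumOrder : PartialOrder (𝒰.ι ⊕ 𝒱.ι) := fibreOrder (Sum.elim id r.map)

/-- A refinement of an ordered cover, with the order induced by the refinement map. -/
def refine : OrderedOpenCover X where
  toOpenCover := 𝒱
  order := @PartialOrder.lift _ _ (𝒰.sumOrder r) Sum.inr Sum.inr_injective
  total a b x ha hb :=
    fibreOrder_total (Sum.elim id r.map) (a := Sum.inr a) (b := Sum.inr b)
      (𝒰.total _ _ x (r.le a ha) (r.le b hb))

/-- The cover of `X × [0,1]` by `U × [0,1)` and `V × (0,1]`, for the members `U` of a cover and the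
members `V` of a refinement. -/
def cylinder : OrderedOpenCover (X × Set.Icc (0 : ℝ) 1) where
  ι := 𝒰.ι ⊕ 𝒱.ι
  U := Sum.elim
    (fun α => ⟨(𝒰.U α : Set X) ×ˢ Set.Iio 1, (𝒰.U α).isOpen.prod isOpen_Iio⟩)
    (fun a => ⟨(𝒱.U a : Set X) ×ˢ Set.Ioi 0, (𝒱.U a).isOpen.prod isOpen_Ioi⟩)
  exists_mem := by
    rintro ⟨x, t⟩
    by_cases ht : t < 1
    · obtain ⟨α, hα⟩ := 𝒰.exists_mem x
      exact ⟨Sum.inl α, hα, ht⟩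
    · obtain ⟨a, ha⟩ := 𝒱.exists_mem x
      exact ⟨Sum.inr a, ha, lt_of_lt_of_le zero_lt_one (not_lt.mp ht)⟩
  order := 𝒰.sumOrder r
  total a b p ha hb := by
    have h : ∀ c : 𝒰.ι ⊕ 𝒱.ι, p ∈ (Sum.elim
        (fun α => ⟨(𝒰.U α : Set X) ×ˢ Set.Iio 1, (𝒰.U α).isOpen.prod isOpen_Iio⟩)
        (fun a => ⟨(𝒱.U a : Set X) ×ˢ Set.Ioi 0, (𝒱.U a).isOpen.prod isOpen_Ioi⟩) c :
          Opens (X × Set.Icc (0 : ℝ) 1)) → p.1 ∈ 𝒰.U (Sum.elim id r.map c) := by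
      rintro (α | a) hp
      · exact hp.1
      · exact r.le a hp.1
    exact fibreOrder_total (Sum.elim id r.map) (𝒰.total _ _ p.1 (h a ha) (h b hb))

theorem cylinder_mem (c : (𝒰.cylinder r).ι) (p : X × Set.Icc (0 : ℝ) 1)
    (hp : p ∈ (𝒰.cylinder r).U c) : p.1 ∈ 𝒰.U (Sum.elim id r.map c) := by
  rcases c with α | a
  · exact hp.1
  · exact r.le a hp.1

theorem monotone_cylinder :
    Monotone (fun c : (𝒰.cylinder r).ι => (Sum.elim id r.map c : 𝒰.ι)) :=
  fun _ _ h => le_of_fibreOrder_le _ h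

theorem monotone_refine : Monotone (fun a : (𝒰.refine r).ι => r.map a) :=
  fun _ _ h => le_of_fibreOrder_le (Sum.elim id r.map) h

theorem cylinder_inl_le_iff {α β : 𝒰.ι} :
    (𝒰.cylinder r).order.le (Sum.inl α) (Sum.inl β) ↔ α ≤ β := by
  refine ⟨fun h => 𝒰.monotone_cylinder r h, fun h => ?_⟩
  rcases h.eq_or_lt with rfl | h
  · exact (𝒰.cylinder r).order.le_refl _
  · exact fibreOrder_le_of_lt (Sum.elim id r.map) h

end OrderedOpenCover

end Covers

section Bundles

variable {E : Type*} [NormedAddCommGroup E] [NormedSpace ℝ E] {H : Type*} [TopologicalSpace H]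
variable {I : ModelWithCorners ℝ E H} {X : Type u} [TopologicalSpace X] [ChartedSpace H X]

namespace TwoVectorBundle

variable (𝓔 : TwoVectorBundle I X n) {𝒱 : OpenCover X} (r : 𝓔.cover.toOpenCover.Refinement 𝒱)

/-- The restriction of a bundle to a refinement of its cover. -/
def refine : TwoVectorBundle I X n :=
  𝓔.pull contMDiff_id (𝓔.cover.refine r) (𝓔.cover.monotone_refine r) fun a _ hy => r.le a hy

/-- The cobordism between a bundle and its restriction to a refinement. -/
def cylinder : TwoVectorBundle (I.prod (𝓡∂ 1)) (X × Set.Icc (0 : ℝ) 1) n :=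
  𝓔.pull contMDiff_fst (𝓔.cover.cylinder r) (𝓔.cover.monotone_cylinder r)
    (𝓔.cover.cylinder_mem r)

theorem cylinder_restrictsTo_zero : (𝓔.cylinder r).RestrictsTo 0 𝓔 := by
  let f : {α : 𝓔.cover.ι // ∃ x, x ∈ 𝓔.cover.U α} →
      {c : (𝓔.cylinder r).cover.ι //
        ∃ x, (x, (0 : Set.Icc (0 : ℝ) 1)) ∈ (𝓔.cylinder r).cover.U c} :=
    fun α => ⟨Sum.inl α.1, α.2.imp fun _ hx =>
      ⟨hx, show (0 : Set.Icc (0 : ℝ) 1) < 1 from zero_lt_one⟩⟩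
  have hf : Function.Bijective f := by
    constructor
    · intro α β h
      exact Subtype.ext (Sum.inl_injective (congrArg Subtype.val h))
    · rintro ⟨α | a, x, hx⟩
      · exact ⟨⟨α, x, hx.1⟩, rfl⟩
      · exact absurd (show (0 : Set.Icc (0 : ℝ) 1) < 0 from hx.2) (lt_irrefl _)
  refine ⟨⟨Equiv.ofBijective f hf, 𝓔.cover.cylinder_inl_le_iff r⟩, ?_, ?_, ?_⟩
  · intro α x
    exact ⟨fun hx => ⟨hx, show (0 : Set.Icc (0 : ℝ) 1) < 1 from zero_lt_one⟩, fun hx => hx.1⟩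
  · intro α β h x _ _
    exact (extObj_of_lt (show α.1 < β.1 from h)).symm
  · intro α β γ h h' x hx hx'
    have he := extφ_of_lt (show α.1 < β.1 from h) (show β.1 < γ.1 from h') x hx.1.1 hx.1.2 hx.2
    refine HEq.trans ?_ (heq_of_eq he.symm)
    exact (Mor.cast_heq _ _ _).symm

theorem cylinder_restrictsTo_one : (𝓔.cylinder r).RestrictsTo 1 (𝓔.refine r) := by
  let f : {a : (𝓔.refine r).cover.ι // ∃ x, x ∈ (𝓔.refine r).cover.U a} →
      {c : (𝓔.cylinder r).cover.ι //
        ∃ x, (x, (1 : Set.Icc (0 : ℝ) 1)) ∈ (𝓔.cylinder r).cover.U c} :=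
    fun a => ⟨Sum.inr a.1, a.2.imp fun _ hx =>
      ⟨hx, show (0 : Set.Icc (0 : ℝ) 1) < 1 from zero_lt_one⟩⟩
  have hf : Function.Bijective f := by
    constructor
    · intro α β h
      exact Subtype.ext (Sum.inr_injective (congrArg Subtype.val h))
    · rintro ⟨α | a, x, hx⟩
      · exact absurd (show (1 : Set.Icc (0 : ℝ) 1) < 1 from hx.2) (lt_irrefl _)
      · exact ⟨⟨a, x, hx.1⟩, rfl⟩
  refine ⟨⟨Equiv.ofBijective f hf, Iff.rfl⟩, ?_, ?_, ?_⟩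
  · intro a x
    exact ⟨fun hx => ⟨hx, show (0 : Set.Icc (0 : ℝ) 1) < 1 from zero_lt_one⟩, fun hx => hx.1⟩
  · intro a b h x _ _
    rfl
  · intro a b c h h' x hx hx'
    rfl

theorem equivalent_refine : 𝓔.Equivalent (𝓔.refine r) :=
  ⟨𝓔.cylinder r, ⟨1, one_pos, fun _ _ _ _ _ _ _ _ => rfl⟩, 𝓔.cylinder_restrictsTo_zero r,
    𝓔.cylinder_restrictsTo_one r⟩

/-- A trivialization of the signs on a refinement orients the restriction of the bundle. -/
def orientedRefine (h : 𝒱.Cochain 2) (hh : 𝒱.δ h = r.pullback 𝓔.sgnCochain) :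
    OrientedTwoVectorBundle I X n where
  cover := (𝓔.refine r).cover
  obj := (𝓔.refine r).obj
  weaklyInvertible := (𝓔.refine r).weaklyInvertible
  obj_mul := (𝓔.refine r).obj_mul
  φ {a b c} hab hbc y := ((𝓔.refine r).φ hab hbc y, h ![a, b, c] ⟨y.1, fun i => by
    fin_cases i
    exacts [y.2.1.1, y.2.1.2, y.2.2]⟩)
  smooth {a b c} hab hbc := by
    refine ⟨(𝓔.refine r).smooth hab hbc, ?_⟩
    exact (h ![a, b, c]).isLocallyConstant.comp_continuous (continuous_subtype_val.subtype_mk _)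
  coherent {a b c d} hab hbc hcd y ha hb hc hd := by
    refine Prod.ext ((𝓔.refine r).coherent hab hbc hcd y ha hb hc hd) ?_
    have hy : y ∈ 𝒱.inter ![a, b, c, d] := OpenCover.mem_inter_four ha hb hc hd
    have h1 := DFunLike.congr_fun (congrFun hh ![a, b, c, d]) ⟨y, hy⟩
    rw [OpenCover.δ_apply, Fin.prod_univ_four, OpenCover.Refinement.pullback_apply] at h1
    have hmono : Monotone (r.map ∘ ![a, b, c, d]) := by
      rw [Fin.monotone_iff_le_succ]
      intro i
      fin_cases i
      exacts [𝓔.cover.monotone_refine r hab.le, 𝓔.cover.monotone_refine r hbc.le,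
        𝓔.cover.monotone_refine r hcd.le]
    have h2 := h1.trans ((𝓔.sgnCochain_apply _ _).trans (assocSgn_extObj hmono).symm)
    have hat : ∀ (s t : Fin 3 → 𝒱.ι) (hst : s = t) (hs : y ∈ 𝒱.inter s) (ht : y ∈ 𝒱.inter t),
        h s ⟨y, hs⟩ = h t ⟨y, ht⟩ := by
      rintro s _ rfl _ _
      rfl
    have hi : ∀ {i j k : 𝒱.ι}, y ∈ 𝒱.U i → y ∈ 𝒱.U j → y ∈ 𝒱.U k → y ∈ 𝒱.inter ![i, j, k] := by
      intro i j k hi hj hk l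
      fin_cases l <;> assumption
    have h3 : _ = h ![b, c, d] ⟨y, hi hb hc hd⟩ * h ![a, c, d] ⟨y, hi ha hc hd⟩ *
        h ![a, b, d] ⟨y, hi ha hb hd⟩ * h ![a, b, c] ⟨y, hi ha hb hc⟩ :=
      h2.symm.trans (congrArg₂ (· * ·) (congrArg₂ (· * ·) (congrArg₂ (· * ·)
        (hat (![a, b, c, d] ∘ Fin.succAbove 0) ![b, c, d] (List.ofFn_inj.mp rfl) _ _)
        (hat (![a, b, c, d] ∘ Fin.succAbove 1) ![a, c, d] (List.ofFn_inj.mp rfl) _ _))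
        (hat (![a, b, c, d] ∘ Fin.succAbove 2) ![a, b, d] (List.ofFn_inj.mp rfl) _ _))
        (hat (![a, b, c, d] ∘ Fin.succAbove 3) ![a, b, c] (List.ofFn_inj.mp rfl) _ _))
    show assocSgn _ _ _ * ((h ![a, b, c] ⟨y, _⟩ * 1) * h ![a, c, d] ⟨y, _⟩) =
      (1 * h ![b, c, d] ⟨y, _⟩) * h ![a, b, d] ⟨y, _⟩
    refine (congrArg (· * _) h3).trans ?_
    generalize h ![a, b, c] _ = p
    generalize h ![a, b, d] _ = q
    generalize h ![a, c, d] _ = u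
    generalize h ![b, c, d] _ = v
    clear * -
    revert p q u v
    decide

/-- Bundles with a trivial class are orientable. -/
theorem orientable_of_cechClass_eq_one
    (h : cechClass 𝓔.cover.toOpenCover 𝓔.sgnCochain 𝓔.isCocycle_sgnCochain = 1) :
    𝓔.Orientable := by
  obtain ⟨𝒱, r, k, hk⟩ := OpenCover.exists_isCoboundary_of_cechClass_eq_one _ _ _ h
  exact ⟨𝓔.orientedRefine r k hk, 𝓔.equivalent_refine r⟩

end TwoVectorBundle

end Bundles

end TwoVect

end

theorem mainTheorem1 {E : Type*} [NormedAddCommGroup E] [NormedSpace ℝ E] {H : Type*}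
    [TopologicalSpace H] (I : ModelWithCorners ℝ E H) (X : Type u) [TopologicalSpace X]
    [ChartedSpace H X] [IsManifold I ∞ X] [T2Space X] [ParacompactSpace X] (n : ℕ) :
    ∃ hc : ∀ 𝓔 : TwoVect.TwoVectorBundle I X n,
        𝓔.cover.toOpenCover.IsCocycle 𝓔.sgnCochain,
      (∀ 𝓔₀ 𝓔₁ : TwoVect.TwoVectorBundle I X n, 𝓔₀.Equivalent 𝓔₁ →
        TwoVect.cechClass 𝓔₀.cover.toOpenCover 𝓔₀.sgnCochain (hc 𝓔₀) =
          TwoVect.cechClass 𝓔₁.cover.toOpenCover 𝓔₁.sgnCochain (hc 𝓔₁)) ∧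
      (∀ 𝓔 : TwoVect.TwoVectorBundle I X n,
        TwoVect.cechClass 𝓔.cover.toOpenCover 𝓔.sgnCochain (hc 𝓔) = 1 ↔ 𝓔.Orientable) :=
  ⟨fun 𝓔 => 𝓔.isCocycle_sgnCochain, fun _ _ h => h.cechClass_eq,
    fun 𝓔 => ⟨𝓔.orientable_of_cechClass_eq_one, fun h => h.cechClass_eq_one⟩⟩
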